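/- There is an absolute constant $C>0$ such that the following holds. Let $\mathcal W$ be a real Hilbert space with inner product $\langle\cdot,\cdot\rangle$ and norm $\|w\|=\sqrt{\langle w,w\rangle}$, let $T\ge 0$ be an integer, and let $\|\cdot\|_1,\dots,\|\cdot\|_{T+1}$ be norms on $\mathcal W$, each induced by an inner product on $\mathcal W$ (for example $\|w\|_t=\sqrt{\langle w,M_tw\rangle}$ with $M_t$ a positive definite self-adjoint operator), such that $\|w\|\le\|w\|_t$ for all $1\le t\le T+1$ and $\|w\|_t\le\|w\|_{t+1}$ for all $1\le t\le T$, for every $w\in\mathcal W$. For $g\in\mathcal W$ let $\|g\|_{t,*}=\sup\{\langle g,h\rangle:\|h\|_t=1\}$. Let $G,\varepsilon>0$, let $\ell_1,\dots,\ell_T:\mathcal W\to\mathbb R$ be convex, let $w_1,\dots,w_T\in\mathcal W$, and let $g_t\in\partial\ell_t(w_t)$ (that is, $\ell_t(v)\ge\ell_t(w_t)+\langle g_t,v-w_t\rangle$ for all $v\in\mathcal W$) with $\|g_t\|_{t,*}\le G$ for $1\le t\le T$. Put $$V_t=4G^2+\sum_{s=1}^{t-1}\|g_s\|_{s,*}^2,\qquad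 \alpha_t=\frac{\varepsilon G}{\sqrt{V_t}\,\log^2(V_t/G^2)},$$ $$\psi_t(w)=3\int_0^{\|w\|_t}\ \inf_{0<\eta\le 1/G}\Big[\frac{\log(x/\alpha_t+1)}{\eta}+\eta V_t\Big]dx,$$ and suppose that the points $w_t$ are the FTRL iterates for these regularizers, i.e. for every $1\le t\le T$ the point $w_t$ minimizes $w\mapsto\big\langle\sum_{s=1}^{t-1}g_s,w\big\rangle+\psi_t(w)$ over $\mathcal W$. Then for every $u\in\mathcal W$ the static regret $R_T(u)=\sum_{t=1}^T(\ell_t(w_t)-\ell_t(u))$ satisfies $$R_T(u)\le C\Big(G\varepsilon+\big(1+\log\log(V_T/G^2)\big)\,\|u\|_{T+1}\max\Big\{\sqrt{V_T\log\Big(\tfrac{\|u\|_{T+1}\sqrt{V_T}}{\varepsilon G}+1\Big)},\ G\log\Big(\tfrac{\|u\|_{T+1}\sqrt{V_T}}{\varepsilon G}+1\Big)\Big\}\Big).$$ -/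

import Mathlib

open scoped InnerProductSpace

noncomputable section

namespace FTRL

variable {W : Type*} [NormedAddCommGroup W] [InnerProductSpace ℝ W]

/-- The norm `‖w‖_P = √⟨w, w⟩_P` of a (further) inner product `P` on `W`. For
`⟨v, w⟩_P = ⟨v, M w⟩` this is the weighted norm `‖w‖_M = √⟨w, M w⟩`. -/
def ipNorm (P : InnerProductSpace.Core ℝ W) (w : W) : ℝ :=
  √(P.inner w w)

/-- The dual norm `sup {⟨g, h⟩ : N h = 1}` of `N`, where `⟨·, ·⟩` is the inner product of the
Hilbert space `W`. -/
def dualNorm (N : W → ℝ) (g : W) : ℝ :=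
  sSup ((fun h : W => ⟪g, h⟫_ℝ) '' {h : W | N h = 1})

/-- `V_t = 4 G² + ∑_{s=1}^{t-1} ‖g_s‖_{s,*}²`. -/
def V (G : ℝ) (N : ℕ → W → ℝ) (g : ℕ → W) (t : ℕ) : ℝ :=
  4 * G ^ 2 + ∑ s ∈ Finset.Ico 1 t, dualNorm (N s) (g s) ^ 2

/-- `α_t = ε G / (√V_t log²(V_t / G²))`, as a function of the value `v` of `V_t`. -/
def alpha (G ε v : ℝ) : ℝ :=
  ε * G / (√v * Real.log (v / G ^ 2) ^ 2)

/-- `min_{η ≤ 1/G} [log(x/α_t + 1)/η + η V_t]` over step sizes `η > 0`, as a function of the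
value `v` of `V_t`. It is an infimum, which at `x = 0` is `0` and is not attained. -/
def slope (G ε v x : ℝ) : ℝ :=
  sInf ((fun η : ℝ => Real.log (x / alpha G ε v + 1) / η + η * v) '' Set.Ioc 0 (1 / G))

/-- The regularizer `ψ_t(w) = 3 ∫_0^{‖w‖_t} min_{η ≤ 1/G} [log(x/α_t + 1)/η + η V_t] dx`. -/
def psi (G ε : ℝ) (N : ℕ → W → ℝ) (g : ℕ → W) (t : ℕ) (w : W) : ℝ :=
  3 * ∫ x in (0 : ℝ)..(N t w), slope G ε (V G N g t) x

/-- The FTRL objective `⟨∑_{s=1}^{t-1} g_s, w⟩ + ψ_t(w)`, which `w_t` minimizes. -/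
def objective (G ε : ℝ) (N : ℕ → W → ℝ) (g : ℕ → W) (t : ℕ) (w : W) : ℝ :=
  ⟪∑ s ∈ Finset.Ico 1 t, g s, w⟫_ℝ + psi G ε N g t w

/-- `g` is a subgradient of `f` at `w`. -/
def IsSubgradientAt (f : W → ℝ) (g w : W) : Prop :=
  ∀ v : W, f w + ⟪g, v - w⟫_ℝ ≤ f v

/-- The static regret `R_T(u) = ∑_{t=1}^T (ℓ_t(w_t) - ℓ_t(u))`. -/
def regret (l : ℕ → W → ℝ) (w : ℕ → W) (T : ℕ) (u : W) : ℝ :=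
  ∑ t ∈ Finset.Icc 1 T, (l t (w t) - l t u)

end FTRL

end

/-!
The minimal value of the FTRL objective grows in round `t` by at least the linearized loss
`⟨g_t, w_t⟩`, up to an error of order `γ² α_t / √V_t` with `γ = ‖g_t‖_{t,*}`. The factor `log²` in
`α_t` makes these errors telescope to `O(G ε)`, so that the regret is at most `O(G ε) + ψ_{T+1}(u)`.

For a single round, write the regularizer as `φ(‖·‖)`. The first-order condition at the minimizer
`x` turns the growth of the objective from `x` to `y` into the Bregman divergence of `φ` from `‖x‖`
to `‖y‖` plus the angular term `φ'(‖x‖) (‖y‖ - ⟨x, y⟩ / ‖x‖)`. Together with a multiple of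
`γ² ‖y‖ η`, where `η` is the step size attaining the infimum that defines `φ'(‖y‖)`, they outweigh
the change `γ ‖y - x‖` of the linearized loss. This last multiple is paid for by the regularizer
itself: when `V_t` increases by `γ²`, each infimum increases by at least `γ²` times its new
minimizer.
-/

namespace FTRL

/-- The minimizer `min (√(L / v)) (1 / G)` of `η ↦ L / η + η v` over `(0, 1 / G]` for `0 < L`.
For `L ≤ 0` it takes the value `0`, outside this interval. -/
noncomputable def stepSize (G v L : ℝ) : ℝ := min (√(L / v)) (1 / G)

/-- The infimum of `η ↦ L / η + η v` over `(0, 1 / G]` for `0 ≤ L`. At `L = 0`, where it is not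
attained, the convention `L / 0 = 0` yields the correct value `0`. -/
noncomputable def stepCost (G v L : ℝ) : ℝ := L / stepSize G v L + stepSize G v L * v

/-- The order of magnitude `max (√(v L)) (G L)` of `stepCost G v L`, in which the regret bound is
expressed. -/
noncomputable def rate (G v L : ℝ) : ℝ := max (√(v * L)) (G * L)

section StepSize

variable {G v L : ℝ}

lemma rate_nonneg : 0 ≤ rate G v L := (Real.sqrt_nonneg _).trans (le_max_left _ _)

lemma rate_le_mul_rate {c v' L' : ℝ} (hG : 0 ≤ G) (hc : 0 ≤ c)
    (hvL : v' * L' ≤ c ^ 2 * (v * L)) (hL : L' ≤ c * L) :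
    rate G v' L' ≤ c * rate G v L := by
  rw [rate, rate, mul_max_of_nonneg _ _ hc]
  refine max_le_max ?_ ?_
  · rw [← Real.sqrt_sq hc, ← Real.sqrt_mul (sq_nonneg c)]
    exact Real.sqrt_le_sqrt hvL
  · calc G * L' ≤ G * (c * L) := by gcongr
      _ = c * (G * L) := by ring

lemma stepSize_nonneg (hG : 0 ≤ G) : 0 ≤ stepSize G v L :=
  le_min (Real.sqrt_nonneg _) (by positivity)

lemma stepSize_pos (hG : 0 < G) (hv : 0 < v) (hL : 0 < L) : 0 < stepSize G v L :=
  lt_min (Real.sqrt_pos.2 (by positivity)) (by positivity)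

lemma stepSize_of_nonpos (hG : 0 ≤ G) (hv : 0 ≤ v) (hL : L ≤ 0) : stepSize G v L = 0 := by
  rw [stepSize, Real.sqrt_eq_zero_of_nonpos (div_nonpos_of_nonpos_of_nonneg hL hv)]
  exact min_eq_left (by positivity)

lemma stepSize_mono (hv : 0 ≤ v) : Monotone (stepSize G v) := fun L₁ L₂ hL => by
  unfold stepSize
  gcongr

lemma mul_stepSize_le_one {γ : ℝ} (hG : 0 < G) (hγ : γ ≤ G) : γ * stepSize G v L ≤ 1 :=
  calc γ * stepSize G v L ≤ G * (1 / G) :=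
        mul_le_mul hγ (min_le_right _ _) (stepSize_nonneg hG.le) hG.le
    _ = 1 := mul_one_div_cancel hG.ne'

lemma mul_stepSize_le_stepSize {v₁ v₂ L₁ L₂ c : ℝ} (hG : 0 ≤ G) (hc : 0 ≤ c) (hc1 : c ≤ 1)
    (h : c ^ 2 * (L₁ / v₁) ≤ L₂ / v₂) : c * stepSize G v₁ L₁ ≤ stepSize G v₂ L₂ := by
  refine le_min ?_ ?_
  · calc c * stepSize G v₁ L₁ ≤ c * √(L₁ / v₁) := by gcongr; exact min_le_left _ _
      _ = √(c ^ 2 * (L₁ / v₁)) := by rw [Real.sqrt_mul (sq_nonneg c), Real.sqrt_sq hc]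
      _ ≤ √(L₂ / v₂) := Real.sqrt_le_sqrt h
  · exact (mul_le_of_le_one_left (stepSize_nonneg hG) hc1).trans (min_le_right _ _)

lemma sqrt_div_mul_self (hv : 0 < v) : √(L / v) * v = √(v * L) := by
  rw [show v * L = L / v * v ^ 2 by field_simp, Real.sqrt_mul' _ (sq_nonneg v),
    Real.sqrt_sq hv.le]

lemma div_stepSize (hG : 0 < G) (hv : 0 < v) : L / stepSize G v L = rate G v L := by
  rcases le_or_gt L 0 with hL | hL
  · rw [stepSize_of_nonpos hG.le hv.le hL, div_zero, rate,
      Real.sqrt_eq_zero_of_nonpos (mul_nonpos_of_nonneg_of_nonpos hv.le hL),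
      max_eq_left (mul_nonpos_of_nonneg_of_nonpos hG.le hL)]
  have hs : 0 < √(L / v) := Real.sqrt_pos.2 (by positivity)
  have hsqrt : √(v * L) = L / √(L / v) := by
    rw [eq_div_iff hs.ne', ← sqrt_div_mul_self hv, mul_right_comm,
      Real.mul_self_sqrt (by positivity), div_mul_cancel₀ _ hv.ne']
  have hinv : G * L = L / (1 / G) := by field_simp
  rw [rate, hsqrt, hinv, stepSize]
  rcases le_total (√(L / v)) (1 / G) with h | h
  · rw [min_eq_left h, max_eq_left (div_le_div_of_nonneg_left hL.le hs h)]
  · rw [min_eq_right h, max_eq_right (div_le_div_of_nonneg_left hL.le (by positivity) h)]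

lemma stepCost_eq_rate_add (hG : 0 < G) (hv : 0 < v) :
    stepCost G v L = rate G v L + stepSize G v L * v := by
  rw [stepCost, div_stepSize hG hv]

lemma stepCost_of_nonpos (hG : 0 ≤ G) (hv : 0 ≤ v) (hL : L ≤ 0) : stepCost G v L = 0 := by
  rw [stepCost, stepSize_of_nonpos hG hv hL, div_zero, zero_mul, add_zero]

lemma rate_le_stepCost (hG : 0 < G) (hv : 0 < v) : rate G v L ≤ stepCost G v L := by
  rw [stepCost_eq_rate_add hG hv]
  exact le_add_of_nonneg_right (mul_nonneg (stepSize_nonneg hG.le) hv.le)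

lemma stepCost_nonneg (hG : 0 < G) (hv : 0 < v) : 0 ≤ stepCost G v L :=
  rate_nonneg.trans (rate_le_stepCost hG hv)

lemma stepCost_le_two_mul_rate (hG : 0 < G) (hv : 0 < v) : stepCost G v L ≤ 2 * rate G v L := by
  have hstep : stepSize G v L * v ≤ rate G v L :=
    calc stepSize G v L * v ≤ √(L / v) * v := by gcongr; exact min_le_left _ _
      _ = √(v * L) := sqrt_div_mul_self hv
      _ ≤ rate G v L := le_max_left _ _
  rw [stepCost_eq_rate_add hG hv]
  linarith

lemma continuous_stepCost (hG : 0 < G) (hv : 0 < v) : Continuous (stepCost G v) := by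
  rw [show stepCost G v = fun L => rate G v L + stepSize G v L * v from
    funext fun _ => stepCost_eq_rate_add hG hv]
  unfold rate stepSize
  fun_prop

lemma stepCost_le_div_add {η : ℝ} (hG : 0 < G) (hv : 0 < v) (hL : 0 ≤ L) (hη : 0 < η)
    (hηG : η ≤ 1 / G) : stepCost G v L ≤ L / η + η * v := by
  rcases hL.eq_or_lt with rfl | hL
  · rw [stepCost_of_nonpos hG.le hv.le le_rfl]; positivity
  have hσ := stepSize_pos hG hv hL
  have hσv : √(L / v) ^ 2 * v = L := by
    rw [Real.sq_sqrt (by positivity), div_mul_cancel₀ _ hv.ne']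
  have hsign : 0 ≤ (stepSize G v L - η) * (L - stepSize G v L * η * v) := by
    rcases le_or_gt η (stepSize G v L) with h | h
    · refine mul_nonneg (sub_nonneg.2 h) (sub_nonneg.2 ?_)
      calc stepSize G v L * η * v ≤ √(L / v) * √(L / v) * v := by
            gcongr
            exacts [min_le_left _ _, h.trans (min_le_left _ _)]
        _ = L := by rw [← sq, hσv]
    · have hsqrt : stepSize G v L = √(L / v) :=
        (min_choice _ _).resolve_right fun h' => (hηG.trans_eq h'.symm).not_gt h
      refine mul_nonneg_of_nonpos_of_nonpos (sub_nonpos.2 h.le) (sub_nonpos.2 ?_)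
      calc L = stepSize G v L * stepSize G v L * v := by rw [← sq, hsqrt, hσv]
        _ ≤ stepSize G v L * η * v := by gcongr
  have hdiff : L / η + η * v - stepCost G v L =
      (stepSize G v L - η) * (L - stepSize G v L * η * v) / (η * stepSize G v L) := by
    rw [stepCost]
    field_simp
    ring
  rw [← sub_nonneg, hdiff]
  positivity

lemma isGLB_stepCost (hG : 0 < G) (hv : 0 < v) (hL : 0 ≤ L) :
    IsGLB ((fun η : ℝ => L / η + η * v) '' Set.Ioc 0 (1 / G)) (stepCost G v L) := by
  rcases hL.eq_or_lt with rfl | hL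
  · rw [stepCost_of_nonpos hG.le hv.le le_rfl]
    simpa using (OrderIso.mulRight₀ v hv).isGLB_image'.2 (isGLB_Ioc (one_div_pos.2 hG))
  · refine IsLeast.isGLB ⟨⟨stepSize G v L, ⟨stepSize_pos hG hv hL, min_le_right _ _⟩, rfl⟩, ?_⟩
    rintro _ ⟨η, hη, rfl⟩
    exact stepCost_le_div_add hG hv hL.le hη.1 hη.2

/-- As an infimum of functions affine in `(L, v)`, the cost is concave; the step size chosen at
`(L₂, v₂)` is a supergradient there. -/
lemma stepCost_add_le {v₁ v₂ L₁ L₂ : ℝ} (hG : 0 < G) (hv₁ : 0 < v₁) (hv₂ : 0 < v₂)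
    (hL₁ : 0 ≤ L₁) (hL : L₁ ≤ L₂) :
    stepCost G v₁ L₁ + (L₂ - L₁) / stepSize G v₂ L₂ + stepSize G v₂ L₂ * (v₂ - v₁) ≤
      stepCost G v₂ L₂ := by
  rcases (hL₁.trans hL).eq_or_lt with rfl | hL₂
  · rw [stepSize_of_nonpos hG.le hv₂.le le_rfl, stepCost_of_nonpos hG.le hv₁.le hL,
      stepCost_of_nonpos hG.le hv₂.le le_rfl]
    simp
  · have h := stepCost_le_div_add hG hv₁ hL₁ (stepSize_pos hG hv₂ hL₂) (min_le_right _ _)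
    rw [stepCost.eq_def G v₂, sub_div]
    linarith

lemma sub_div_stepSize_le_stepCost_sub {L₁ L₂ L₃ : ℝ} (hG : 0 < G) (hv : 0 < v) (hL₁ : 0 ≤ L₁)
    (h₁₂ : L₁ ≤ L₂) (h₂₃ : L₂ ≤ L₃) :
    (L₂ - L₁) / stepSize G v L₃ ≤ stepCost G v L₂ - stepCost G v L₁ := by
  have hconcave := stepCost_add_le hG hv hv hL₁ h₁₂
  rw [sub_self, mul_zero, add_zero] at hconcave
  have hstep : (L₂ - L₁) / stepSize G v L₃ ≤ (L₂ - L₁) / stepSize G v L₂ := by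
    rcases h₁₂.eq_or_lt with rfl | h
    · simp
    · exact div_le_div_of_nonneg_left (sub_nonneg.2 h₁₂) (stepSize_pos hG hv (hL₁.trans_lt h))
        (stepSize_mono hv.le h₂₃)
  linarith

lemma stepCost_monotoneOn (hG : 0 < G) (hv : 0 < v) : MonotoneOn (stepCost G v) (Set.Ici 0) :=
  fun _ hL₁ _ _ hL => sub_nonneg.1 <|
    (div_nonneg (sub_nonneg.2 hL) (stepSize_nonneg hG.le)).trans
      (sub_div_stepSize_le_stepCost_sub hG hv hL₁ hL le_rfl)

end StepSize

/-- The logarithm `log (x / α + 1)` occurring in the regularizer. -/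
noncomputable def logRatio (α x : ℝ) : ℝ := Real.log (x / α + 1)

section LogRatio

variable {α x y c : ℝ}

lemma logRatio_zero : logRatio α 0 = 0 := by simp [logRatio]

lemma logRatio_nonneg (hα : 0 ≤ α) (hx : 0 ≤ x) : 0 ≤ logRatio α x :=
  Real.log_nonneg (le_add_of_nonneg_left (by positivity))

lemma logRatio_pos (hα : 0 < α) (hx : 0 < x) : 0 < logRatio α x :=
  Real.log_pos (lt_add_of_pos_left _ (by positivity))

lemma logRatio_monotoneOn (hα : 0 ≤ α) : MonotoneOn (logRatio α) (Set.Ici 0) :=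
  fun x hx y _ hxy => by
    have : 0 ≤ x / α := div_nonneg hx hα
    exact Real.log_le_log (by linarith) (by gcongr)

lemma logRatio_anti {β : ℝ} (hβ : 0 < β) (hβα : β ≤ α) (hx : 0 ≤ x) :
    logRatio α x ≤ logRatio β x := by
  have : 0 ≤ x / α := div_nonneg hx (hβ.le.trans hβα)
  exact Real.log_le_log (by linarith) (by gcongr)

lemma logRatio_eq_log_sub_log (hα : 0 < α) (hx : 0 ≤ x) :
    logRatio α x = Real.log (x + α) - Real.log α := by
  rw [logRatio, ← Real.log_div (by positivity) hα.ne', add_div, div_self hα.ne']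

lemma logRatio_le_div (hα : 0 ≤ α) (hx : 0 ≤ x) : logRatio α x ≤ x / α := by
  have h := Real.log_le_sub_one_of_pos (show 0 < x / α + 1 by positivity)
  rwa [add_sub_cancel_right] at h

lemma div_add_one_le_log {z : ℝ} (hz : 0 ≤ z) : z / (z + 1) ≤ Real.log (z + 1) := by
  have h := Real.one_sub_inv_le_log_of_pos (show 0 < z + 1 by positivity)
  rwa [show 1 - (z + 1)⁻¹ = z / (z + 1) by field_simp; ring] at h

lemma mul_logRatio_le (hα : 0 ≤ α) (hx : 0 ≤ x) (hc : 0 ≤ c) (hc1 : c ≤ 1) :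
    c * logRatio α x ≤ logRatio α (c * x) := by
  have hpos : x / α + 1 ∈ Set.Ioi (0 : ℝ) := Set.mem_Ioi.2 (by positivity)
  have h := strictConcaveOn_log_Ioi.concaveOn.2 (Set.mem_Ioi.2 one_pos) hpos
    (sub_nonneg.2 hc1) hc (sub_add_cancel 1 c)
  simp only [Real.log_one, smul_eq_mul, mul_zero, zero_add] at h
  refine h.trans_eq (congrArg Real.log ?_)
  ring

lemma sq_mul_logRatio_le (hα : 0 ≤ α) (hx : 0 ≤ x) (hc : 0 ≤ c) (hc1 : c ≤ 1) (hy : c * x ≤ y) :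
    c ^ 2 * logRatio α x ≤ logRatio α y :=
  calc c ^ 2 * logRatio α x ≤ c * logRatio α x :=
        mul_le_mul_of_nonneg_right (pow_le_of_le_one hc hc1 two_ne_zero) (logRatio_nonneg hα hx)
    _ ≤ logRatio α (c * x) := mul_logRatio_le hα hx hc hc1
    _ ≤ logRatio α y := logRatio_monotoneOn hα (mul_nonneg hc hx) ((mul_nonneg hc hx).trans hy) hy

lemma continuousAt_logRatio (hα : 0 < α) (hx : -α < x) : ContinuousAt (logRatio α) x := by
  have : x / α + 1 ≠ 0 := by
    rw [div_add_one hα.ne']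
    exact div_ne_zero (by linarith) hα.ne'
  unfold logRatio
  fun_prop (disch := assumption)

end LogRatio

/-- The step size at which the infimum defining the slope of the regularizer at radius `x` is
attained. -/
noncomputable def radialStep (G v α x : ℝ) : ℝ := stepSize G v (logRatio α x)

/-- The radial slope of the regularizer, with the scale `α` left as a free parameter. -/
noncomputable def radialSlope (G v α x : ℝ) : ℝ := stepCost G v (logRatio α x)

/-- The regularizer as a function of the radius `r = ‖w‖_t`. -/
noncomputable def potential (G v α r : ℝ) : ℝ := 3 * ∫ x in (0 : ℝ)..r, radialSlope G v α x

/-- The Bregman divergence of `potential`, from `a` to `b`. -/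
noncomputable def bregman (G v α b a : ℝ) : ℝ :=
  potential G v α b - potential G v α a - 3 * radialSlope G v α a * (b - a)

/-- The coefficient of `γ ^ 2` in the price of one round with gradient norm `γ`, for a competitor
at radius `b`. Increasing `v` by `γ ^ 2` lets the regularizer absorb the first summand; the second
one telescopes over the rounds. -/
noncomputable def stability (G v α b : ℝ) : ℝ :=
  4 / 3 * (b * radialStep G v α b) + 100 * (α / √v)

section Potential

variable {G v α a b : ℝ}

lemma slope_eq_radialSlope {ε x : ℝ} (hG : 0 < G) (hv : 0 < v) (hα : 0 ≤ alpha G ε v)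
    (hx : 0 ≤ x) : slope G ε v x = radialSlope G v (alpha G ε v) x :=
  (isGLB_stepCost hG hv (logRatio_nonneg hα hx)).csInf_eq
    ((Set.nonempty_Ioc.2 (one_div_pos.2 hG)).image _)

lemma radialSlope_zero (hG : 0 ≤ G) (hv : 0 ≤ v) : radialSlope G v α 0 = 0 :=
  stepCost_of_nonpos hG hv logRatio_zero.le

lemma radialSlope_nonneg (hG : 0 < G) (hv : 0 < v) : 0 ≤ radialSlope G v α a :=
  stepCost_nonneg hG hv

lemma radialSlope_pos (hG : 0 < G) (hv : 0 < v) (hα : 0 < α) (ha : 0 < a) :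
    0 < radialSlope G v α a :=
  (Real.sqrt_pos.2 (mul_pos hv (logRatio_pos hα ha))).trans_le
    ((le_max_left _ _).trans (rate_le_stepCost hG hv))

lemma radialSlope_monotoneOn (hG : 0 < G) (hv : 0 < v) (hα : 0 ≤ α) :
    MonotoneOn (radialSlope G v α) (Set.Ici 0) :=
  (stepCost_monotoneOn hG hv).comp (logRatio_monotoneOn hα) fun _ hx => logRatio_nonneg hα hx

lemma continuousAt_radialSlope {x : ℝ} (hG : 0 < G) (hv : 0 < v) (hα : 0 < α) (hx : -α < x) :
    ContinuousAt (radialSlope G v α) x :=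
  (continuous_stepCost hG hv).continuousAt.comp (continuousAt_logRatio hα hx)

lemma uIcc_subset_Ici (ha : 0 ≤ a) (hb : 0 ≤ b) : Set.uIcc a b ⊆ Set.Ici 0 :=
  fun _ hx => (le_min ha hb).trans hx.1

lemma intervalIntegrable_radialSlope (hG : 0 < G) (hv : 0 < v) (hα : 0 ≤ α) (ha : 0 ≤ a)
    (hb : 0 ≤ b) : IntervalIntegrable (radialSlope G v α) MeasureTheory.volume a b :=
  ((radialSlope_monotoneOn hG hv hα).mono (uIcc_subset_Ici ha hb)).intervalIntegrable

lemma potential_zero : potential G v α 0 = 0 := by simp [potential]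

lemma potential_sub (hG : 0 < G) (hv : 0 < v) (hα : 0 ≤ α) (ha : 0 ≤ a) (hb : 0 ≤ b) :
    potential G v α b - potential G v α a = 3 * ∫ x in a..b, radialSlope G v α x := by
  rw [potential, potential, ← mul_sub, intervalIntegral.integral_interval_sub_left
    (intervalIntegrable_radialSlope hG hv hα le_rfl hb)
    (intervalIntegrable_radialSlope hG hv hα le_rfl ha)]

lemma potential_monotoneOn (hG : 0 < G) (hv : 0 < v) (hα : 0 ≤ α) :
    MonotoneOn (potential G v α) (Set.Ici 0) := fun a ha b hb hab => by
  rw [← sub_nonneg, potential_sub hG hv hα ha hb]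
  exact mul_nonneg zero_le_three
    (intervalIntegral.integral_nonneg hab fun _ _ => radialSlope_nonneg hG hv)

lemma potential_nonneg (hG : 0 < G) (hv : 0 < v) (hα : 0 ≤ α) (ha : 0 ≤ a) :
    0 ≤ potential G v α a :=
  potential_zero.symm.trans_le
    (potential_monotoneOn hG hv hα Set.self_mem_Ici (Set.mem_Ici.2 ha) ha)

lemma potential_le (hG : 0 < G) (hv : 0 < v) (hα : 0 ≤ α) (ha : 0 ≤ a) :
    potential G v α a ≤ 3 * (a * radialSlope G v α a) := by
  have hint : ∫ x in (0 : ℝ)..a, radialSlope G v α x ≤ ∫ _ in (0 : ℝ)..a, radialSlope G v α a :=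
    intervalIntegral.integral_mono_on ha (intervalIntegrable_radialSlope hG hv hα le_rfl ha)
      intervalIntegrable_const
      fun _ hx => radialSlope_monotoneOn hG hv hα hx.1 (Set.mem_Ici.2 ha) hx.2
  rw [intervalIntegral.integral_const, sub_zero, smul_eq_mul] at hint
  exact mul_le_mul_of_nonneg_left hint zero_le_three

lemma hasDerivAt_potential (hG : 0 < G) (hv : 0 < v) (hα : 0 < α) (ha : 0 ≤ a) :
    HasDerivAt (potential G v α) (3 * radialSlope G v α a) a := by
  have hcont : ContinuousOn (radialSlope G v α) (Set.Ioi (-α)) := fun x hx =>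
    (continuousAt_radialSlope hG hv hα hx).continuousWithinAt
  have haα : -α < a := by linarith
  exact (intervalIntegral.integral_hasDerivAt_right
    (intervalIntegrable_radialSlope hG hv hα.le le_rfl ha)
    (hcont.stronglyMeasurableAtFilter isOpen_Ioi a haα)
    (continuousAt_radialSlope hG hv hα haα)).const_mul 3

end Potential

section RadialStep

variable {G v α x : ℝ}

lemma radialStep_pos (hG : 0 < G) (hv : 0 < v) (hα : 0 < α) (hx : 0 < x) :
    0 < radialStep G v α x :=
  stepSize_pos hG hv (logRatio_pos hα hx)

lemma mul_radialStep_le {c y : ℝ} (hG : 0 ≤ G) (hv : 0 ≤ v) (hα : 0 ≤ α) (hc : 0 ≤ c)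
    (hc1 : c ≤ 1) (hx : 0 ≤ x) (hy : c * x ≤ y) :
    c * radialStep G v α x ≤ radialStep G v α y := by
  refine mul_stepSize_le_stepSize hG hc hc1 ?_
  rw [← mul_div_assoc]
  exact div_le_div_of_nonneg_right (sq_mul_logRatio_le hα hx hc hc1 hy) hv

lemma radialStep_le_div_sqrt {m : ℝ} (hv : 0 ≤ v) (hα : 0 < α) (hx : 0 ≤ x) (hm : 0 ≤ m)
    (hxm : x ≤ m ^ 2 * α) : radialStep G v α x ≤ m / √v :=
  calc radialStep G v α x ≤ √(logRatio α x / v) := min_le_left _ _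
    _ ≤ √(m ^ 2 / v) := by
        gcongr
        exact (logRatio_le_div hα.le hx).trans ((div_le_iff₀ hα).2 hxm)
    _ = m / √v := by rw [Real.sqrt_div' _ hv, Real.sqrt_sq hm]

end RadialStep

section Bregman

variable {G v α a b γ : ℝ}

lemma bregman_self : bregman G v α a a = 0 := by simp [bregman]

lemma bregman_eq_integral (hG : 0 < G) (hv : 0 < v) (hα : 0 ≤ α) (ha : 0 ≤ a) (hb : 0 ≤ b) :
    bregman G v α b a = 3 * ∫ x in a..b, (radialSlope G v α x - radialSlope G v α a) := by
  rw [bregman, potential_sub hG hv hα ha hb, intervalIntegral.integral_sub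
    (intervalIntegrable_radialSlope hG hv hα ha hb) intervalIntegrable_const,
    intervalIntegral.integral_const, smul_eq_mul]
  ring

lemma integral_sub_left_nonneg {f : ℝ → ℝ} (hf : MonotoneOn f (Set.uIcc a b)) :
    0 ≤ ∫ x in a..b, (f x - f a) := by
  rcases le_total a b with hab | hba
  · rw [Set.uIcc_of_le hab] at hf
    exact intervalIntegral.integral_nonneg hab fun x hx =>
      sub_nonneg.2 (hf (Set.left_mem_Icc.2 hab) hx hx.1)
  · rw [Set.uIcc_of_ge hba] at hf
    rw [intervalIntegral.integral_symm, ← intervalIntegral.integral_neg]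
    refine intervalIntegral.integral_nonneg hba fun x hx => ?_
    rw [neg_sub, sub_nonneg]
    exact hf hx (Set.right_mem_Icc.2 hba) hx.2

lemma bregman_nonneg (hG : 0 < G) (hv : 0 < v) (hα : 0 ≤ α) (ha : 0 ≤ a) (hb : 0 ≤ b) :
    0 ≤ bregman G v α b a := by
  rw [bregman_eq_integral hG hv hα ha hb]
  exact mul_nonneg zero_le_three
    (integral_sub_left_nonneg ((radialSlope_monotoneOn hG hv hα).mono (uIcc_subset_Ici ha hb)))

lemma intervalIntegrable_logRatio (hα : 0 ≤ α) (ha : 0 ≤ a) (hb : 0 ≤ b) :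
    IntervalIntegrable (logRatio α) MeasureTheory.volume a b :=
  ((logRatio_monotoneOn hα).mono (uIcc_subset_Ici ha hb)).intervalIntegrable

lemma integral_logRatio_sub (hα : 0 < α) (ha : 0 ≤ a) (hb : 0 ≤ b) :
    ∫ x in a..b, (logRatio α x - logRatio α a) =
      (b + α) * ((a + α) / (b + α) - 1 - Real.log ((a + α) / (b + α))) := by
  have hcongr : ∫ x in a..b, (logRatio α x - logRatio α a) =
      ∫ x in a..b, (Real.log (x + α) - Real.log (a + α)) :=
    intervalIntegral.integral_congr fun x hx => by
      simp only [logRatio_eq_log_sub_log hα ha,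
        logRatio_eq_log_sub_log hα (uIcc_subset_Ici ha hb hx)]
      ring
  have hint : IntervalIntegrable (fun x => Real.log (x + α)) MeasureTheory.volume a b :=
    by simpa using (intervalIntegral.intervalIntegrable_log'
      (a := a + α) (b := b + α)).comp_add_right α
  rw [hcongr, intervalIntegral.integral_sub hint intervalIntegrable_const,
    intervalIntegral.integral_comp_add_right Real.log, integral_log,
    intervalIntegral.integral_const, smul_eq_mul, Real.log_div (by positivity) (by positivity)]
  field_simp
  ring

lemma radialSlope_sub_div_monotoneOn (hG : 0 < G) (hv : 0 < v) (hα : 0 ≤ α) (ha : 0 ≤ a)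
    (hb : 0 ≤ b) :
    MonotoneOn (fun x => radialSlope G v α x - logRatio α x / radialStep G v α (max a b))
      (Set.uIcc a b) := fun x hx y hy hxy => by
  have hx0 := uIcc_subset_Ici ha hb hx
  have hy0 := uIcc_subset_Ici ha hb hy
  have hL := logRatio_monotoneOn hα
  have h := sub_div_stepSize_le_stepCost_sub hG hv (logRatio_nonneg hα hx0) (hL hx0 hy0 hxy)
    (hL hy0 (Set.mem_Ici.2 (ha.trans (le_max_left a b))) hy.2)
  rw [sub_div] at h
  simp only [radialSlope, radialStep]
  linarith

/-- The slope grows at least like `logRatio / η`, where `η` is the step size at the larger of the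
two radii, so that `bregman` dominates the corresponding divergence of `logRatio`. -/
lemma le_bregman (hG : 0 < G) (hv : 0 < v) (hα : 0 < α) (ha : 0 ≤ a) (hb : 0 ≤ b) :
    (b + α) / radialStep G v α (max a b) *
      (3 * ((a + α) / (b + α) - 1 - Real.log ((a + α) / (b + α)))) ≤ bregman G v α b a := by
  set η := radialStep G v α (max a b)
  have hLint : IntervalIntegrable (fun x => (logRatio α x - logRatio α a) / η)
      MeasureTheory.volume a b :=
    ((intervalIntegrable_logRatio hα.le ha hb).sub intervalIntegrable_const).div_const η
  have hmono : 0 ≤ ∫ x in a..b, (radialSlope G v α x - radialSlope G v α a -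
      (logRatio α x - logRatio α a) / η) :=
    (integral_sub_left_nonneg (radialSlope_sub_div_monotoneOn hG hv hα.le ha hb)).trans_eq
      (intervalIntegral.integral_congr fun x _ => by ring)
  rw [intervalIntegral.integral_sub ((intervalIntegrable_radialSlope hG hv hα.le ha hb).sub
    intervalIntegrable_const) hLint, intervalIntegral.integral_div,
    integral_logRatio_sub hα ha hb, sub_nonneg] at hmono
  calc _ = 3 * ((b + α) * ((a + α) / (b + α) - 1 - Real.log ((a + α) / (b + α))) / η) := by ring
    _ ≤ 3 * ∫ x in a..b, (radialSlope G v α x - radialSlope G v α a) := by gcongr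
    _ = bregman G v α b a := (bregman_eq_integral hG hv hα.le ha hb).symm

end Bregman

section LogBounds

variable {e r : ℝ}

/-- The Fenchel-Young inequality for `r ↦ 3 (r - 1 - log r)`, in the form
`log (r (1 - e / 3)) ≤ r (1 - e / 3) - 1`. -/
lemma mul_sub_one_sub_sq_le (he : e ≤ 1) (hr : 0 < r) :
    e * (r - 1) - e ^ 2 / 2 ≤ 3 * (r - 1 - Real.log r) := by
  have hk : 0 < 1 - e / 3 := by linarith
  have hlog := Real.log_le_sub_one_of_pos (mul_pos hr hk)
  rw [Real.log_mul hr.ne' hk.ne'] at hlog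
  have hlogk := Real.one_sub_inv_le_log_of_pos hk
  have hinv : (1 - e / 3)⁻¹ ≤ 1 + e / 3 + e ^ 2 / 6 := by
    rw [inv_le_iff_one_le_mul₀ hk]
    nlinarith [mul_nonneg (sq_nonneg e) (sub_nonneg.2 he)]
  linarith

lemma sub_one_le_three_mul_sub_log (hr : 11 / 5 ≤ r) :
    r - 1 ≤ 3 * (r - 1 - Real.log r) := by
  have hlog := Real.log_le_sub_one_of_pos (show 0 < r / 2 by linarith)
  rw [Real.log_div (by linarith) two_ne_zero] at hlog
  linarith [Real.log_two_lt_d9]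

end LogBounds

section Stability

variable {G v α a b γ : ℝ}

lemma stability_nonneg (hG : 0 ≤ G) (hα : 0 ≤ α) (hb : 0 ≤ b) : 0 ≤ stability G v α b := by
  have : 0 ≤ radialStep G v α b := stepSize_nonneg hG
  unfold stability
  positivity

lemma mul_sub_le_bregman_add (hG : 0 < G) (hv : 0 < v) (hα : 0 < α) (ha : 0 ≤ a) (hb : 0 ≤ b)
    (hγ : γ ≤ G) :
    γ * (a - b) ≤
      bregman G v α b a + γ ^ 2 * ((b + α) * radialStep G v α (max a b) / 2) := by
  rcases (ha.trans (le_max_left a b)).eq_or_lt with hmax | hmax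
  · obtain rfl : a = 0 := le_antisymm ((le_max_left a b).trans_eq hmax.symm) ha
    obtain rfl : b = 0 := le_antisymm ((le_max_right 0 b).trans_eq hmax.symm) hb
    have : 0 ≤ radialStep G v α (max 0 0) := stepSize_nonneg hG.le
    rw [sub_self, mul_zero, bregman_self]
    positivity
  have hη := radialStep_pos hG hv hα hmax
  set η := radialStep G v α (max a b)
  have hlog := mul_sub_one_sub_sq_le (mul_stepSize_le_one hG hγ : γ * η ≤ 1)
    (show 0 < (a + α) / (b + α) by positivity)
  calc γ * (a - b) = (b + α) / η * (γ * η * ((a + α) / (b + α) - 1) - (γ * η) ^ 2 / 2) +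
        γ ^ 2 * ((b + α) * η / 2) := by field_simp; ring
    _ ≤ _ := by
      gcongr
      exact (mul_le_mul_of_nonneg_left hlog (by positivity)).trans (le_bregman hG hv hα ha hb)

lemma mul_radialStep_max_le_stability (hG : 0 ≤ G) (hv : 0 ≤ v) (hα : 0 < α) (ha : 0 ≤ a)
    (hb : 0 ≤ b) (hab : a + α ≤ 11 / 5 * (b + α)) :
    (b + α) * radialStep G v α (max a b) / 2 ≤ stability G v α b := by
  have hmax : max a b ≤ 11 / 5 * b + 6 / 5 * α := max_le (by linarith) (by linarith)
  have hmax0 := ha.trans (le_max_left a b)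
  have hη : 0 ≤ radialStep G v α (max a b) := stepSize_nonneg hG
  have : 0 ≤ α / √v := by positivity
  rcases le_total (20 * α) b with hbα | hbα
  · have hstep : 50 / 113 * radialStep G v α (max a b) ≤ radialStep G v α b :=
      mul_radialStep_le hG hv hα.le (by norm_num) (by norm_num) hmax0 (by linarith)
    calc (b + α) * radialStep G v α (max a b) / 2
        ≤ 21 / 20 * b * radialStep G v α (max a b) / 2 := by gcongr; linarith
      _ ≤ 4 / 3 * (b * (50 / 113 * radialStep G v α (max a b))) := by
          linarith [mul_nonneg hb hη]
      _ ≤ 4 / 3 * (b * radialStep G v α b) := by gcongr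
      _ ≤ stability G v α b := le_add_of_nonneg_right (by positivity)
  · calc (b + α) * radialStep G v α (max a b) / 2 ≤ (21 * α) * (7 / √v) / 2 := by
          gcongr
          · linarith
          · exact radialStep_le_div_sqrt hv hα hmax0 (by norm_num) (by linarith)
      _ = 147 / 2 * (α / √v) := by ring
      _ ≤ 100 * (α / √v) := by gcongr; norm_num
      _ ≤ stability G v α b :=
          le_add_of_nonneg_left (mul_nonneg (by norm_num) (mul_nonneg hb (stepSize_nonneg hG)))

lemma mul_sub_le_bregman (hG : 0 < G) (hv : 0 < v) (hα : 0 < α) (hb : 0 ≤ b) (hγ : γ ≤ G)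
    (hab : 11 / 5 * (b + α) ≤ a + α) : γ * (a - b) ≤ bregman G v α b a := by
  have hba : b ≤ a := by linarith
  have hη := radialStep_pos (x := max a b) hG hv hα (lt_max_of_lt_left (by linarith))
  set η := radialStep G v α (max a b)
  have hbα : 0 < b + α := by positivity
  calc γ * (a - b) = (b + α) / η * (γ * η * ((a + α) / (b + α) - 1)) := by field_simp; ring
    _ ≤ (b + α) / η * ((a + α) / (b + α) - 1) := by
        have hr : 0 ≤ (a + α) / (b + α) - 1 := by
          rw [sub_nonneg, one_le_div hbα]
          linarith
        gcongr
        exact mul_le_of_le_one_left hr (mul_stepSize_le_one hG hγ)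
    _ ≤ (b + α) / η * (3 * ((a + α) / (b + α) - 1 - Real.log ((a + α) / (b + α)))) := by
        gcongr
        exact sub_one_le_three_mul_sub_log ((le_div_iff₀ hbα).2 hab)
    _ ≤ bregman G v α b a := le_bregman hG hv hα (hb.trans hba) hb

lemma mul_abs_sub_le_bregman_add (hG : 0 < G) (hv : 0 < v) (hα : 0 < α) (ha : 0 ≤ a)
    (hb : 0 ≤ b) (hγ : 0 ≤ γ) (hγG : γ ≤ G) :
    γ * |b - a| ≤ bregman G v α b a + γ ^ 2 * stability G v α b := by
  rcases le_total (a + α) (11 / 5 * (b + α)) with hab | hab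
  · have hstab := mul_le_mul_of_nonneg_left
      (mul_radialStep_max_le_stability hG.le hv.le hα ha hb hab) (sq_nonneg γ)
    have hpos := mul_sub_le_bregman_add hG hv hα ha hb hγG
    have hneg := mul_sub_le_bregman_add hG hv hα ha hb (neg_le_self hγ |>.trans hγG)
    rw [neg_sq] at hneg
    rcases abs_choice (b - a) with h | h <;> rw [h] <;> linarith
  · rw [abs_sub_comm, abs_of_nonneg (by linarith)]
    exact (mul_sub_le_bregman hG hv hα hb hγG hab).trans
      (le_add_of_nonneg_right (mul_nonneg (sq_nonneg γ) (stability_nonneg hG.le hα.le hb)))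

lemma div_radialSlope_le_of_le (hG : 0 < G) (hv : 0 < v) (hα : 0 < α) (ha : 0 < a)
    (haα : a ≤ 40 * α) : a / (3 * radialSlope G v α a) ≤ 41 / 3 * (α / √v) := by
  have hz : a / α ≤ 40 := (div_le_iff₀ hα).2 haα
  have hlog : a / α / 41 ≤ logRatio α a :=
    calc a / α / 41 ≤ a / α / (a / α + 1) := by gcongr; linarith
      _ ≤ logRatio α a := div_add_one_le_log (by positivity)
  have hsq : (a / α / 41) ^ 2 ≤ a / α / 41 :=
    pow_le_of_le_one (by positivity) (by linarith) two_ne_zero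
  have hslope : √v * (a / α / 41) ≤ radialSlope G v α a :=
    calc √v * (a / α / 41) ≤ √v * √(logRatio α a) := by
          gcongr
          exact Real.le_sqrt_of_sq_le (hsq.trans hlog)
      _ = √(v * logRatio α a) := (Real.sqrt_mul hv.le _).symm
      _ ≤ rate G v (logRatio α a) := le_max_left _ _
      _ ≤ radialSlope G v α a := rate_le_stepCost hG hv
  calc a / (3 * radialSlope G v α a) ≤ a / (3 * (√v * (a / α / 41))) := by gcongr
    _ = 41 / 3 * (α / √v) := by field_simp

lemma one_le_logRatio (hα : 0 < α) (haα : 40 * α ≤ a) : 1 ≤ logRatio α a := by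
  have hz : 40 ≤ a / α := (le_div_iff₀ hα).2 haα
  rw [logRatio, Real.le_log_iff_exp_le (by linarith)]
  linarith [Real.exp_one_lt_d9]

lemma two_mul_le_radialSlope (hG : 0 < G) (hv : 4 * G ^ 2 ≤ v) (hL : 1 ≤ logRatio α a) :
    2 * G ≤ radialSlope G v α a := by
  have hv0 : 0 < v := lt_of_lt_of_le (by positivity) hv
  calc 2 * G ≤ √(v * logRatio α a) := Real.le_sqrt_of_sq_le (by nlinarith)
    _ ≤ rate G v (logRatio α a) := le_max_left _ _
    _ ≤ radialSlope G v α a := rate_le_stepCost hG hv0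

lemma div_radialSlope_le_mul_radialStep (hG : 0 < G) (hv : 0 < v) (ha : 0 ≤ a)
    (hL : 1 ≤ logRatio α a) : a / (3 * radialSlope G v α a) ≤ a * radialStep G v α a / 3 := by
  have hη : 0 < radialStep G v α a := stepSize_pos hG hv (one_pos.trans_le hL)
  have hslope : 1 / radialStep G v α a ≤ radialSlope G v α a :=
    calc 1 / radialStep G v α a ≤ logRatio α a / radialStep G v α a := by gcongr
      _ ≤ radialSlope G v α a := le_add_of_nonneg_right (mul_nonneg hη.le hv.le)
  calc a / (3 * radialSlope G v α a) ≤ a / (3 * (1 / radialStep G v α a)) := by gcongr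
    _ = a * radialStep G v α a / 3 := by field_simp

lemma div_radialSlope_le_stability (hG : 0 < G) (hv : 4 * G ^ 2 ≤ v) (hα : 0 < α) (ha : 0 < a)
    (hb : 0 ≤ b) (hγ : γ ≤ G) (hab : |b - a| * (3 * radialSlope G v α a) ≤ a * γ) :
    a / (3 * radialSlope G v α a) ≤ stability G v α b := by
  have hv0 : 0 < v := lt_of_lt_of_le (by positivity) hv
  have hηa : 0 ≤ radialStep G v α a := stepSize_nonneg hG.le
  have hηb : 0 ≤ radialStep G v α b := stepSize_nonneg hG.le
  rcases le_total a (40 * α) with haα | haα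
  · calc a / (3 * radialSlope G v α a) ≤ 41 / 3 * (α / √v) :=
          div_radialSlope_le_of_le hG hv0 hα ha haα
      _ ≤ 100 * (α / √v) := by gcongr; norm_num
      _ ≤ stability G v α b := le_add_of_nonneg_left (by positivity)
  · have hL := one_le_logRatio hα haα
    have hba : 5 / 6 * a ≤ b := by
      have h6 : |b - a| * (6 * G) ≤ a / 6 * (6 * G) :=
        calc |b - a| * (6 * G) ≤ |b - a| * (3 * radialSlope G v α a) :=
              mul_le_mul_of_nonneg_left (by linarith [two_mul_le_radialSlope hG hv hL])
                (abs_nonneg _)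
          _ ≤ a * γ := hab
          _ ≤ a / 6 * (6 * G) := by linarith [mul_le_mul_of_nonneg_left hγ ha.le]
      linarith [(abs_le.1 (le_of_mul_le_mul_right h6 (by positivity))).1]
    have hstep : 5 / 6 * radialStep G v α a ≤ radialStep G v α b :=
      mul_radialStep_le hG.le hv0.le hα.le (by norm_num) (by norm_num) ha.le hba
    calc a / (3 * radialSlope G v α a) ≤ a * radialStep G v α a / 3 :=
          div_radialSlope_le_mul_radialStep hG hv0 ha.le hL
      _ ≤ 4 / 3 * (5 / 6 * a * (5 / 6 * radialStep G v α a)) := by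
          linarith [mul_nonneg ha.le hηa]
      _ ≤ 4 / 3 * (b * radialStep G v α b) := by gcongr
      _ ≤ stability G v α b := le_add_of_nonneg_right (by positivity)

end Stability

section VarianceUpdate

variable {G v α α' b γ : ℝ}

lemma radialSlope_add_le (hG : 0 < G) (hv : 4 * G ^ 2 ≤ v) (hα' : 0 < α') (hαα' : α' ≤ α)
    (hγ : 0 ≤ γ) (hγG : γ ≤ G) {x : ℝ} (hx : 0 ≤ x) (hb : 0 < b) (hxb : x ≤ b) :
    radialSlope G v α x + 8 / 9 * (x / b) * radialStep G v α b * γ ^ 2 ≤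
      radialSlope G (v + γ ^ 2) α' x := by
  have hα : 0 < α := hα'.trans_le hαα'
  have hv0 : 0 < v := lt_of_lt_of_le (by positivity) hv
  have hv' : 0 < v + γ ^ 2 := by positivity
  have hvv : v + γ ^ 2 ≤ 5 / 4 * v := by nlinarith
  have hL := logRatio_anti hα' hαα' hx
  have hLb := logRatio_nonneg hα.le hb.le
  have hcost := stepCost_add_le hG hv0 hv' (logRatio_nonneg hα.le hx) hL
  rw [add_sub_cancel_left] at hcost
  have hgain : 0 ≤ (logRatio α' x - logRatio α x) / stepSize G (v + γ ^ 2) (logRatio α' x) :=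
    div_nonneg (sub_nonneg.2 hL) (stepSize_nonneg hG.le)
  have hxb1 : x / b ≤ 1 := (div_le_one hb).2 hxb
  have hstep : 8 / 9 * (x / b) * radialStep G v α b ≤ radialStep G (v + γ ^ 2) α' x := by
    refine mul_stepSize_le_stepSize hG.le (by positivity) (by linarith) ?_
    have hlog0 : 0 ≤ (x / b) ^ 2 * logRatio α b := by positivity
    have hlog : (x / b) ^ 2 * logRatio α b ≤ logRatio α' x :=
      (sq_mul_logRatio_le hα.le hb.le (by positivity) hxb1
        (div_mul_cancel₀ x hb.ne').le).trans hL
    calc (8 / 9 * (x / b)) ^ 2 * (logRatio α b / v)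
        = 80 / 81 * ((x / b) ^ 2 * logRatio α b) / (5 / 4 * v) := by ring
      _ ≤ logRatio α' x / (v + γ ^ 2) := by
          gcongr
          · exact hlog0.trans hlog
          · linarith
  have hstep' := mul_le_mul_of_nonneg_right hstep (sq_nonneg γ)
  simp only [radialSlope, radialStep] at hstep' ⊢
  linarith

lemma mul_radialStep_le_potential_sub (hG : 0 < G) (hv : 4 * G ^ 2 ≤ v) (hα' : 0 < α')
    (hαα' : α' ≤ α) (hγ : 0 ≤ γ) (hγG : γ ≤ G) (hb : 0 ≤ b) :
    γ ^ 2 * (4 / 3 * (b * radialStep G v α b)) ≤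
      potential G (v + γ ^ 2) α' b - potential G v α b := by
  rcases hb.eq_or_lt with rfl | hb
  · simp [potential_zero]
  have hα : 0 < α := hα'.trans_le hαα'
  have hv0 : 0 < v := lt_of_lt_of_le (by positivity) hv
  set κ := 8 / 9 * radialStep G v α b * γ ^ 2 / b with hκ
  have hint := intervalIntegrable_radialSlope hG hv0 hα.le le_rfl hb.le
  have hlin : IntervalIntegrable (fun x => κ * x) MeasureTheory.volume 0 b :=
    (continuous_const.mul continuous_id).intervalIntegrable _ _
  have hmono : ∫ x in (0 : ℝ)..b, (radialSlope G v α x + κ * x) ≤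
      ∫ x in (0 : ℝ)..b, radialSlope G (v + γ ^ 2) α' x :=
    intervalIntegral.integral_mono_on hb.le (hint.add hlin)
      (intervalIntegrable_radialSlope hG (by positivity) hα'.le le_rfl hb.le) fun x hx =>
        (radialSlope_add_le hG hv hα' hαα' hγ hγG hx.1 hb hx.2).trans_eq' (by rw [hκ]; ring)
  rw [intervalIntegral.integral_add hint hlin, intervalIntegral.integral_const_mul,
    integral_id] at hmono
  have hquad : κ * ((b ^ 2 - 0 ^ 2) / 2) = 4 / 9 * (γ ^ 2 * (b * radialStep G v α b)) := by
    rw [hκ]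
    field_simp
    ring
  rw [potential, potential]
  linarith

end VarianceUpdate

section Geometry

variable {E : Type*} [NormedAddCommGroup E] [InnerProductSpace ℝ E]

lemma hasDerivAt_comp_norm_add_smul {φ : ℝ → ℝ} {s : ℝ} {x : E} (hφ : HasDerivAt φ s ‖x‖)
    (hs : x = 0 → s = 0) (h : E) :
    HasDerivAt (fun τ : ℝ => φ ‖x + τ • h‖) (s * (⟪x, h⟫_ℝ / ‖x‖)) 0 := by
  rcases eq_or_ne x 0 with rfl | hx
  · rw [hs rfl, norm_zero, hasDerivAt_iff_isLittleO_nhds_zero] at hφ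
    have hnorm : Filter.Tendsto (fun τ : ℝ => ‖τ • h‖) (nhds 0) (nhds 0) :=
      Continuous.tendsto' (by fun_prop) _ _ (by simp)
    have hbig : (fun τ : ℝ => ‖τ • h‖) =O[nhds 0] fun τ => τ :=
      Asymptotics.isBigO_of_le' (c := ‖h‖) _ fun τ => by
        rw [norm_norm, norm_smul, mul_comm]
    rw [hasDerivAt_iff_isLittleO_nhds_zero, hs rfl]
    simpa [Function.comp_def] using (hφ.comp_tendsto hnorm).trans_isBigO hbig
  · have hline : HasDerivAt (fun τ : ℝ => x + τ • h) h 0 := by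
      simpa using ((hasDerivAt_id (0 : ℝ)).smul_const h).const_add x
    have hnorm : HasDerivAt (fun τ : ℝ => ‖x + τ • h‖) (⟪x, h⟫_ℝ / ‖x‖) 0 := by
      have hsqrt := hline.norm_sq.sqrt (by simpa using hx)
      simp only [Real.sqrt_sq (norm_nonneg _), zero_smul, add_zero] at hsqrt
      rwa [mul_div_mul_left _ _ two_ne_zero] at hsqrt
    refine HasDerivAt.comp (0 : ℝ) (h₂ := φ) ?_ hnorm
    simpa using hφ

lemma apply_eq_of_isMinOn_add_comp_norm {φ : ℝ → ℝ} {s : ℝ} {θ : E →ₗ[ℝ] ℝ} {x : E}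
    (hφ : HasDerivAt φ s ‖x‖) (hs : x = 0 → s = 0)
    (hmin : IsMinOn (fun y => θ y + φ ‖y‖) Set.univ x) (h : E) :
    θ h = -(s * (⟪x, h⟫_ℝ / ‖x‖)) := by
  have hlin : HasDerivAt (fun τ : ℝ => θ (x + τ • h)) (θ h) 0 := by
    simpa using ((hasDerivAt_id (0 : ℝ)).mul_const (θ h)).const_add (θ x)
  have hloc : IsLocalMin (fun τ : ℝ => θ (x + τ • h) + φ ‖x + τ • h‖) 0 :=
    Filter.Eventually.of_forall fun τ => by simpa using hmin (Set.mem_univ (x + τ • h))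
  exact eq_neg_of_add_eq_zero_left
    (hloc.hasDerivAt_eq_zero (hlin.add (hasDerivAt_comp_norm_add_smul hφ hs h)))

lemma sub_eq_bregman_add {G v α : ℝ} (hG : 0 < G) (hv : 0 < v) (hα : 0 < α)
    {θ : E →ₗ[ℝ] ℝ} {x : E}
    (hmin : IsMinOn (fun y => θ y + potential G v α ‖y‖) Set.univ x) (y : E) :
    θ y + potential G v α ‖y‖ - (θ x + potential G v α ‖x‖) =
      bregman G v α ‖y‖ ‖x‖ + 3 * radialSlope G v α ‖x‖ * (‖y‖ - ⟪x, y⟫_ℝ / ‖x‖) := by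
  have hfoc := apply_eq_of_isMinOn_add_comp_norm
    (hasDerivAt_potential hG hv hα (norm_nonneg x))
    (fun hx => by rw [hx, norm_zero, radialSlope_zero hG.le hv.le, mul_zero]) hmin
  rw [hfoc x, hfoc y, real_inner_self_eq_norm_mul_norm, mul_self_div_self, bregman]
  ring

/-- When `2 a y = r ^ 2 - d ^ 2`, the function `p y - γ r` of `r ≥ d` is minimal at
`r = max d (a γ / p)`. -/
lemma mul_le_add_or_mul_le_add {p γ a d y r : ℝ} (ha : 0 < a) (hp : 0 < p)
    (hd : 0 ≤ d) (hr : 0 ≤ r) (hy : 0 ≤ y) (h : r ^ 2 = d ^ 2 + 2 * a * y) :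
    γ * r ≤ p * y + γ * d ∨ d * p ≤ a * γ ∧ γ * r ≤ p * y + γ ^ 2 * (a / p) := by
  have hy' : y = (r - d) * (r + d) / (2 * a) := by
    rw [eq_div_iff (by positivity)]
    linarith
  rcases le_total (a * γ) (d * p) with hle | hle
  · have hrd : d ≤ r := le_of_sq_le_sq (by rw [h]; exact le_add_of_nonneg_right (by positivity)) hr
    have hsub : γ * (r - d) ≤ p * y :=
      calc γ * (r - d) = a * γ * (2 * (r - d)) / (2 * a) := by field_simp
        _ ≤ p * (r + d) / 2 * (2 * (r - d)) / (2 * a) := by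
            have : 0 ≤ r - d := sub_nonneg.2 hrd
            gcongr
            linarith [mul_le_mul_of_nonneg_left hrd hp.le]
        _ = p * y := by rw [hy']; ring
    exact Or.inl (by linarith)
  · refine Or.inr ⟨hle, ?_⟩
    have hsq : (d * p) ^ 2 ≤ (a * γ) ^ 2 := by gcongr
    have hamgm : p * y + γ ^ 2 * (a / p) - γ * r =
        ((p * r - a * γ) ^ 2 + ((a * γ) ^ 2 - (d * p) ^ 2)) / (2 * a * p) := by
      rw [hy']
      field_simp
      ring
    rw [← sub_nonneg, hamgm]
    exact div_nonneg (add_nonneg (sq_nonneg _) (sub_nonneg.2 hsq)) (by positivity)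

lemma norm_sub_sq_eq_radial_add {x : E} (hx : x ≠ 0) (y : E) :
    ‖y - x‖ ^ 2 = |‖y‖ - ‖x‖| ^ 2 + 2 * ‖x‖ * (‖y‖ - ⟪x, y⟫_ℝ / ‖x‖) := by
  rw [norm_sub_sq_real, sq_abs, real_inner_comm, mul_sub, mul_assoc 2 ‖x‖ (_ / _),
    mul_div_cancel₀ _ (norm_ne_zero_iff.2 hx)]
  ring

lemma mul_norm_sub_le_bregman_add {G v α γ : ℝ} (hG : 0 < G) (hv : 4 * G ^ 2 ≤ v) (hα : 0 < α)
    (hγ : 0 ≤ γ) (hγG : γ ≤ G) (x y : E) :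
    γ * ‖y - x‖ ≤ bregman G v α ‖y‖ ‖x‖ +
      3 * radialSlope G v α ‖x‖ * (‖y‖ - ⟪x, y⟫_ℝ / ‖x‖) + γ ^ 2 * stability G v α ‖y‖ := by
  have hv0 : 0 < v := lt_of_lt_of_le (by positivity) hv
  have hradial := mul_abs_sub_le_bregman_add hG hv0 hα (norm_nonneg x) (norm_nonneg y) hγ hγG
  rcases eq_or_ne x 0 with rfl | hx
  · rw [norm_zero, sub_zero, abs_norm] at hradial
    rwa [sub_zero, norm_zero, radialSlope_zero hG.le hv0.le, mul_zero, zero_mul, add_zero]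
  have ha := norm_pos_iff.2 hx
  have hslope : 0 < 3 * radialSlope G v α ‖x‖ :=
    mul_pos three_pos (radialSlope_pos hG hv0 hα ha)
  have hangle : 0 ≤ ‖y‖ - ⟪x, y⟫_ℝ / ‖x‖ := by
    rw [sub_nonneg, div_le_iff₀ ha, mul_comm]
    exact real_inner_le_norm x y
  rcases mul_le_add_or_mul_le_add (γ := γ) ha hslope (abs_nonneg _) (norm_nonneg _) hangle
    (norm_sub_sq_eq_radial_add hx y) with h | ⟨hd, h⟩
  · linarith
  · have hstab := mul_le_mul_of_nonneg_left
      (div_radialSlope_le_stability hG hv hα ha (norm_nonneg y) hγG hd) (sq_nonneg γ)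
    linarith [bregman_nonneg hG hv0 hα.le ha.le (norm_nonneg y)]

/-- One round of FTRL; the error term is summable over the rounds. -/
lemma add_apply_sub_le_of_isMinOn {G v α α' γ : ℝ} (hG : 0 < G) (hv : 4 * G ^ 2 ≤ v)
    (hα' : 0 < α') (hαα' : α' ≤ α) (hγ : 0 ≤ γ) (hγG : γ ≤ G) {θ g : E →ₗ[ℝ] ℝ} {x : E}
    (hg : ∀ h, g h ≤ γ * ‖h‖)
    (hmin : IsMinOn (fun y => θ y + potential G v α ‖y‖) Set.univ x) (y : E) :
    θ x + potential G v α ‖x‖ + g x - 100 * (γ ^ 2 * (α / √v)) ≤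
      θ y + g y + potential G (v + γ ^ 2) α' ‖y‖ := by
  have hα : 0 < α := hα'.trans_le hαα'
  have hv0 : 0 < v := lt_of_lt_of_le (by positivity) hv
  have hgrow := mul_radialStep_le_potential_sub hG hv hα' hαα' hγ hγG (norm_nonneg y)
  have hopt := sub_eq_bregman_add hG hv0 hα hmin y
  have hstab := mul_norm_sub_le_bregman_add hG hv hα hγ hγG x y
  have hgxy := hg (x - y)
  rw [map_sub, norm_sub_rev] at hgxy
  rw [stability, mul_add] at hstab
  linarith

end Geometry

section Comparison

lemma one_le_log_of_four_le {a : ℝ} (ha : 4 ≤ a) : 1 ≤ Real.log a := by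
  rw [Real.le_log_iff_exp_le (by linarith)]
  linarith [Real.exp_one_lt_d9]

lemma one_le_log_div_sq {G v : ℝ} (hG : 0 < G) (hv : 4 * G ^ 2 ≤ v) :
    1 ≤ Real.log (v / G ^ 2) :=
  one_le_log_of_four_le ((le_div_iff₀ (by positivity)).2 hv)

lemma log_le_five_fourths_mul_log {a b : ℝ} (ha : 4 ≤ a) (hb : 0 < b) (hba : b ≤ 5 / 4 * a) :
    Real.log b ≤ 5 / 4 * Real.log a := by
  have ha0 : 0 < a := by linarith
  have hratio : b / a ≤ 5 / 4 := (div_le_iff₀ ha0).2 hba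
  have hlog := Real.log_le_sub_one_of_pos (show 0 < b / a by positivity)
  rw [Real.log_div hb.ne' ha0.ne'] at hlog
  linarith [one_le_log_of_four_le ha]

lemma sub_div_mul_log_sq_le {a b : ℝ} (ha : 4 ≤ a) (hab : a ≤ b) (hba : b ≤ 5 / 4 * a) :
    (b - a) / (a * Real.log a ^ 2) ≤ 2 * (1 / Real.log a - 1 / Real.log b) := by
  have ha0 : 0 < a := by linarith
  have hb0 : 0 < b := by linarith
  have hla : 0 < Real.log a := one_pos.trans_le (one_le_log_of_four_le ha)
  have hlb : 0 < Real.log b := one_pos.trans_le (one_le_log_of_four_le (ha.trans hab))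
  have hdiv : 4 / 5 * ((b - a) / a) ≤ Real.log b - Real.log a :=
    calc 4 / 5 * ((b - a) / a) = (b - a) / (5 / 4 * a) := by field_simp
      _ ≤ (b - a) / b := div_le_div_of_nonneg_left (sub_nonneg.2 hab) hb0 hba
      _ = 1 - (b / a)⁻¹ := by field_simp
      _ ≤ Real.log (b / a) := Real.one_sub_inv_le_log_of_pos (by positivity)
      _ = Real.log b - Real.log a := Real.log_div hb0.ne' ha0.ne'
  have hba' : 0 ≤ Real.log b - Real.log a :=
    hdiv.trans' (mul_nonneg (by norm_num) (div_nonneg (sub_nonneg.2 hab) ha0.le))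
  calc (b - a) / (a * Real.log a ^ 2) = (b - a) / a / Real.log a ^ 2 := by field_simp
    _ ≤ 5 / 4 * (Real.log b - Real.log a) / Real.log a ^ 2 := by gcongr; linarith
    _ = 2 * (Real.log b - Real.log a) / (Real.log a * (8 / 5 * Real.log a)) := by
        field_simp
        ring
    _ ≤ 2 * (Real.log b - Real.log a) / (Real.log a * Real.log b) := by
        gcongr
        linarith [log_le_five_fourths_mul_log ha hb0 hba]
    _ = 2 * (1 / Real.log a - 1 / Real.log b) := by field_simp

variable {G ε v v' U : ℝ}

lemma alpha_pos (hG : 0 < G) (hε : 0 < ε) (hv : 4 * G ^ 2 ≤ v) : 0 < alpha G ε v := by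
  have hlog := one_le_log_div_sq hG hv
  have hv0 : 0 < v := lt_of_lt_of_le (by positivity) hv
  unfold alpha
  positivity

lemma alpha_anti (hG : 0 < G) (hε : 0 ≤ ε) (hv : 4 * G ^ 2 ≤ v) (hvv : v ≤ v') :
    alpha G ε v' ≤ alpha G ε v := by
  have hlog := one_le_log_div_sq hG hv
  have hv0 : 0 < v := lt_of_lt_of_le (by positivity) hv
  unfold alpha
  gcongr

/-- The factor `log ^ 2` in `alpha` makes the errors of the rounds telescope. -/
lemma sq_mul_alpha_div_sqrt_le {γ : ℝ} (hG : 0 < G) (hε : 0 ≤ ε) (hv : 4 * G ^ 2 ≤ v)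
    (hγ : 0 ≤ γ) (hγG : γ ≤ G) :
    γ ^ 2 * (alpha G ε v / √v) ≤
      2 * (G * ε) * (1 / Real.log (v / G ^ 2) - 1 / Real.log ((v + γ ^ 2) / G ^ 2)) := by
  have hv0 : 0 < v := lt_of_lt_of_le (by positivity) hv
  have hγ2 : γ ^ 2 ≤ 1 / 4 * v := by nlinarith
  have htele := sub_div_mul_log_sq_le (b := (v + γ ^ 2) / G ^ 2)
    ((le_div_iff₀ (by positivity)).2 hv)
    (by gcongr; exact le_add_of_nonneg_right (sq_nonneg γ))
    (by rw [← mul_div_assoc]; gcongr; linarith)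
  have halpha : alpha G ε v / √v = ε * G / (v * Real.log (v / G ^ 2) ^ 2) := by
    rw [alpha, div_div, mul_right_comm, Real.mul_self_sqrt hv0.le]
  calc γ ^ 2 * (alpha G ε v / √v) = G * ε * (((v + γ ^ 2) / G ^ 2 - v / G ^ 2) /
        (v / G ^ 2 * Real.log (v / G ^ 2) ^ 2)) := by
        rw [halpha]
        field_simp
        ring
    _ ≤ G * ε * (2 * (1 / Real.log (v / G ^ 2) - 1 / Real.log ((v + γ ^ 2) / G ^ 2))) :=
        mul_le_mul_of_nonneg_left htele (mul_nonneg hG.le hε)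
    _ = _ := by ring

lemma logRatio_alpha_le (hG : 0 < G) (hε : 0 < ε) (hv : 4 * G ^ 2 ≤ v) (hvv : v ≤ v')
    (hvv' : v' ≤ 5 / 4 * v) (hU : 0 ≤ U) :
    logRatio (alpha G ε v') U ≤
      Real.log (2 * (U * √v / (ε * G)) * Real.log (v / G ^ 2) ^ 2 + 1) := by
  have hv0 : 0 < v := lt_of_lt_of_le (by positivity) hv
  have hlog' : 0 ≤ Real.log (v' / G ^ 2) :=
    zero_le_one.trans (one_le_log_div_sq hG (hv.trans hvv))
  have hlog : Real.log (v' / G ^ 2) ≤ 5 / 4 * Real.log (v / G ^ 2) :=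
    log_le_five_fourths_mul_log ((le_div_iff₀ (by positivity)).2 hv)
      (div_pos (hv0.trans_le hvv) (by positivity)) (by rw [← mul_div_assoc]; gcongr)
  have hsqrt : √v' ≤ 9 / 8 * √v := by
    rw [Real.sqrt_le_left (by positivity), mul_pow, Real.sq_sqrt hv0.le]
    linarith
  have hratio : U / alpha G ε v' ≤ 2 * (U * √v / (ε * G)) * Real.log (v / G ^ 2) ^ 2 :=
    calc U / alpha G ε v' = U * √v' / (ε * G) * Real.log (v' / G ^ 2) ^ 2 := by
          rw [alpha, div_div_eq_mul_div]
          ring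
      _ ≤ U * (9 / 8 * √v) / (ε * G) * (5 / 4 * Real.log (v / G ^ 2)) ^ 2 := by gcongr
      _ = 225 / 128 * (U * √v / (ε * G) * Real.log (v / G ^ 2) ^ 2) := by ring
      _ ≤ 2 * (U * √v / (ε * G) * Real.log (v / G ^ 2) ^ 2) := by gcongr; norm_num
      _ = _ := by ring
  have hpos : 0 ≤ U / alpha G ε v' := div_nonneg hU (alpha_pos hG hε (hv.trans hvv)).le
  exact Real.log_le_log (by positivity) (by linarith)

variable {z lam μ : ℝ}

lemma log_mul_sq_add_one_le_of_one_le (hz : 1 ≤ z) (hlam : 1 ≤ lam) :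
    Real.log (2 * z * lam ^ 2 + 1) ≤ 3 * (1 + Real.log lam) * Real.log (z + 1) := by
  have hlam0 := Real.log_nonneg hlam
  have hlog2 : Real.log 2 ≤ Real.log (z + 1) := Real.log_le_log two_pos (by linarith)
  have hlog : 2 / 3 ≤ Real.log (z + 1) := by linarith [Real.log_two_gt_d9]
  calc Real.log (2 * z * lam ^ 2 + 1) ≤ Real.log ((z + 1) * (2 * lam ^ 2)) :=
        Real.log_le_log (by positivity) (by nlinarith)
    _ = Real.log (z + 1) + (Real.log 2 + 2 * Real.log lam) := by
        rw [Real.log_mul (by positivity) (by positivity),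
          Real.log_mul two_ne_zero (by positivity), Real.log_pow, Nat.cast_ofNat]
    _ ≤ 3 * (1 + Real.log lam) * Real.log (z + 1) := by
        linarith [mul_le_mul_of_nonneg_left hlog hlam0]

lemma log_mul_sq_add_one_le_of_le_one (hz : 0 ≤ z) (hz1 : z ≤ 1) (hlam : 1 ≤ lam) :
    Real.log (2 * z * lam ^ 2 + 1) ≤ 2 * (1 + Real.log lam) := by
  have hlog3 := Real.log_le_sub_one_of_pos (show (0 : ℝ) < 3 by norm_num)
  calc Real.log (2 * z * lam ^ 2 + 1) ≤ Real.log (3 * lam ^ 2) :=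
        Real.log_le_log (by positivity) (by nlinarith)
    _ = Real.log 3 + 2 * Real.log lam := by
        rw [Real.log_mul three_ne_zero (by positivity), Real.log_pow, Nat.cast_ofNat]
    _ ≤ 2 * (1 + Real.log lam) := by linarith

lemma sqrt_mul_le_one_add (hμ : 1 ≤ μ) (hz : 0 ≤ z) (hz1 : z ≤ 1) :
    √μ * z ≤ 1 + 2 * (μ * (z * √(Real.log (z + 1)))) := by
  rcases le_total (√μ * z) 1 with h | h
  · exact h.trans (le_add_of_nonneg_right (by positivity))
  have hlog : z / 2 ≤ Real.log (z + 1) :=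
    calc z / 2 ≤ z / (z + 1) := by gcongr; linarith
      _ ≤ Real.log (z + 1) := div_add_one_le_log hz
  have hμz : 1 ≤ μ * z :=
    calc 1 ≤ √μ * (√μ * z) := one_le_mul_of_one_le_of_one_le (Real.one_le_sqrt.2 hμ) h
      _ = μ * z := by rw [← mul_assoc, Real.mul_self_sqrt (by positivity)]
  have hhalf : 1 / 2 ≤ √(μ * Real.log (z + 1)) := by
    refine Real.le_sqrt_of_sq_le ?_
    linarith [mul_le_mul_of_nonneg_left hlog (zero_le_one.trans hμ)]
  calc √μ * z = 2 * (√μ * z) * (1 / 2) := by ring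
    _ ≤ 2 * (√μ * z) * √(μ * Real.log (z + 1)) := by gcongr
    _ = 2 * (√μ * √μ * (z * √(Real.log (z + 1)))) := by
        rw [Real.sqrt_mul (by positivity)]
        ring
    _ ≤ 1 + 2 * (μ * (z * √(Real.log (z + 1)))) := by
        rw [Real.mul_self_sqrt (by positivity)]
        exact le_add_of_nonneg_left zero_le_one

lemma mul_sqrt_mul_le_of_le_one {L : ℝ} (hG : 0 < G) (hε : 0 < ε) (hv : 0 ≤ v) (hv' : 0 ≤ v')
    (hvv' : v' ≤ 5 / 4 * v) (hU : 0 ≤ U) (hz : U * √v / (ε * G) ≤ 1) (hμ : 1 ≤ μ)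
    (hL : L ≤ 2 * μ) :
    U * √(v' * L) ≤
      2 * (G * ε) + 4 * (μ * (U * √(v * Real.log (U * √v / (ε * G) + 1)))) := by
  set z := U * √v / (ε * G) with hzdef
  have hUz : U * √v = G * ε * z := by rw [hzdef]; field_simp
  have hsqrt : √(v' * L) ≤ 2 * (√μ * √v) :=
    calc √(v' * L) ≤ √(2 ^ 2 * (μ * v)) := by
          refine Real.sqrt_le_sqrt ?_
          calc v' * L ≤ v' * (2 * μ) := by gcongr
            _ ≤ 5 / 4 * v * (2 * μ) := by gcongr
            _ ≤ 2 ^ 2 * (μ * v) := by linarith [show 0 ≤ μ * v by positivity]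
      _ = 2 * (√μ * √v) := by
          rw [Real.sqrt_mul (sq_nonneg 2), Real.sqrt_sq zero_le_two,
            Real.sqrt_mul (by positivity)]
  calc U * √(v' * L) ≤ U * (2 * (√μ * √v)) := by gcongr
    _ = 2 * (G * ε) * (√μ * z) := by linear_combination 2 * √μ * hUz
    _ ≤ 2 * (G * ε) * (1 + 2 * (μ * (z * √(Real.log (z + 1))))) := by
        gcongr
        exact sqrt_mul_le_one_add hμ (by positivity) hz
    _ = 2 * (G * ε) + 4 * (μ * (U * √(v * Real.log (z + 1)))) := by
        rw [Real.sqrt_mul hv]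
        linear_combination -4 * μ * √(Real.log (z + 1)) * hUz

lemma mul_rate_le_of_le_one {L : ℝ} (hG : 0 < G) (hε : 0 < ε) (hv : 0 ≤ v) (hv' : 0 ≤ v')
    (hvv' : v' ≤ 5 / 4 * v) (hU : 0 ≤ U) (hz : U * √v / (ε * G) ≤ 1) (hμ : 1 ≤ μ)
    (hμv : G * μ ≤ 2 * √v) (hL : L ≤ 2 * μ) :
    U * rate G v' L ≤
      4 * (G * ε + μ * (U * rate G v (Real.log (U * √v / (ε * G) + 1)))) := by
  have hμ0 : 0 ≤ μ := zero_le_one.trans hμ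
  have hrate : 0 ≤ μ * (U * rate G v (Real.log (U * √v / (ε * G) + 1))) :=
    mul_nonneg hμ0 (mul_nonneg hU rate_nonneg)
  rw [rate, mul_max_of_nonneg _ _ hU]
  refine max_le ?_ ?_
  · have hsqrt := mul_sqrt_mul_le_of_le_one hG hε hv hv' hvv' hU hz hμ hL
    have hle_rate : μ * (U * √(v * Real.log (U * √v / (ε * G) + 1))) ≤
        μ * (U * rate G v (Real.log (U * √v / (ε * G) + 1))) := by
      gcongr
      exact le_max_left _ _
    linarith [mul_pos hG hε]
  · have hUv : U * √v ≤ G * ε :=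
      ((div_le_one (by positivity)).1 hz).trans_eq (mul_comm ε G)
    calc U * (G * L) ≤ U * (G * (2 * μ)) := by gcongr
      _ = 2 * U * (G * μ) := by ring
      _ ≤ 2 * U * (2 * √v) := by gcongr
      _ = 4 * (U * √v) := by ring
      _ ≤ 4 * (G * ε) := by gcongr
      _ ≤ _ := by gcongr; exact le_add_of_nonneg_right hrate

lemma mul_log_div_sq_le (hG : 0 < G) (hv : 0 < v) : G * Real.log (v / G ^ 2) ≤ 2 * √v := by
  have hlog := Real.log_le_sub_one_of_pos (show 0 < √v / G by positivity)
  calc G * Real.log (v / G ^ 2) = 2 * (G * Real.log (√v / G)) := by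
        rw [← Real.sq_sqrt hv.le, ← div_pow, Real.log_pow, Real.sqrt_sq (Real.sqrt_nonneg v),
          Nat.cast_ofNat]
        ring
    _ ≤ 2 * (G * (√v / G)) := by gcongr; linarith
    _ = 2 * √v := by field_simp

/-- The logarithm on the right lacks the factor `log ^ 2 (v / G ^ 2)` hidden in `alpha`, which is
the origin of the iterated logarithm. -/
lemma mul_rate_logRatio_alpha_le (hG : 0 < G) (hε : 0 < ε) (hv : 4 * G ^ 2 ≤ v) (hvv : v ≤ v')
    (hvv' : v' ≤ 5 / 4 * v) (hU : 0 ≤ U) :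
    U * rate G v' (logRatio (alpha G ε v') U) ≤
      4 * (G * ε + (1 + Real.log (Real.log (v / G ^ 2))) *
        (U * rate G v (Real.log (U * √v / (ε * G) + 1)))) := by
  have hv0 : 0 < v := lt_of_lt_of_le (by positivity) hv
  have hlam := one_le_log_div_sq hG hv
  have hlogL := logRatio_alpha_le hG hε hv hvv hvv' hU
  have hmul := mul_log_div_sq_le hG hv0
  set lam := Real.log (v / G ^ 2)
  have hμ : 0 ≤ Real.log lam := Real.log_nonneg hlam
  rcases le_total (U * √v / (ε * G)) 1 with hz | hz
  · have hμv : G * (1 + Real.log lam) ≤ 2 * √v := by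
      refine hmul.trans' ?_
      gcongr
      linarith [Real.log_le_sub_one_of_pos (one_pos.trans_le hlam)]
    exact mul_rate_le_of_le_one hG hε hv0.le (hv0.le.trans hvv) hvv' hU hz (by linarith) hμv
      (hlogL.trans (log_mul_sq_add_one_le_of_le_one (by positivity) hz hlam))
  · set l := Real.log (U * √v / (ε * G) + 1)
    have hl : 0 ≤ l := Real.log_nonneg (by linarith)
    have hL := hlogL.trans (log_mul_sq_add_one_le_of_one_le hz hlam)
    have hvL : v' * logRatio (alpha G ε v') U ≤ (3 * (1 + Real.log lam)) ^ 2 * (v * l) :=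
      calc v' * logRatio (alpha G ε v') U ≤ 5 / 4 * v * (3 * (1 + Real.log lam) * l) :=
            mul_le_mul hvv' hL (logRatio_nonneg (alpha_pos hG hε (hv.trans hvv)).le hU)
              (by positivity)
        _ = 15 / 4 * (1 + Real.log lam) * (v * l) := by ring
        _ ≤ (3 * (1 + Real.log lam)) ^ 2 * (v * l) := by gcongr; nlinarith
    have hrate := mul_le_mul_of_nonneg_left (rate_le_mul_rate hG.le (by positivity) hvL hL) hU
    have hpos : 0 ≤ (1 + Real.log lam) * (U * rate G v l) :=
      mul_nonneg (by positivity) (mul_nonneg hU rate_nonneg)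
    linarith [mul_pos hG hε]

end Comparison

variable {W : Type*} [NormedAddCommGroup W] [InnerProductSpace ℝ W]

section DualNorm

variable {p : Seminorm ℝ W} {g : W}

lemma dualNorm_nonneg : 0 ≤ dualNorm p g := by
  rcases {h : W | p h = 1}.eq_empty_or_nonempty with hempty | ⟨h, hh⟩
  · rw [dualNorm, hempty, Set.image_empty, Real.sSup_empty]
  rcases le_total 0 ⟪g, h⟫_ℝ with hgh | hgh
  · exact Real.sSup_nonneg' ⟨_, ⟨h, hh, rfl⟩, hgh⟩
  · refine Real.sSup_nonneg' ⟨_, ⟨-h, ?_, rfl⟩, ?_⟩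
    · rwa [Set.mem_ofPred_eq, map_neg_eq_map]
    · simpa only [inner_neg_right, Left.nonneg_neg_iff] using hgh

lemma inner_le_dualNorm_mul {c : ℝ} (hc : ∀ h, ⟪g, h⟫_ℝ ≤ c * p h) (h : W) :
    ⟪g, h⟫_ℝ ≤ dualNorm p g * p h := by
  rcases (apply_nonneg p h).eq_or_lt with hp | hp
  · simpa only [← hp, mul_zero] using hc h
  have hbdd : BddAbove ((fun h : W => ⟪g, h⟫_ℝ) '' {h : W | p h = 1}) := by
    refine ⟨c, ?_⟩
    rintro _ ⟨k, hk, rfl⟩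
    simpa only [show p k = 1 from hk, mul_one] using hc k
  have hunit : p ((p h)⁻¹ • h) = 1 := by
    rw [map_smul_eq_mul, Real.norm_of_nonneg (by positivity), inv_mul_cancel₀ hp.ne']
  have hle : ⟪g, (p h)⁻¹ • h⟫_ℝ ≤ dualNorm p g := le_csSup hbdd ⟨_, hunit, rfl⟩
  rwa [real_inner_smul_right, inv_mul_le_iff₀ hp, mul_comm] at hle

/-- `ipNorm P` as a seminorm. It is a norm, but homogeneity and the triangle inequality are all
that the dual norm needs. -/
noncomputable def ipSeminorm (P : InnerProductSpace.Core ℝ W) : Seminorm ℝ W :=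
  @normSeminorm ℝ W _ P.toNormedAddCommGroup.toSeminormedAddCommGroup
    (InnerProductSpace.ofCore P.toCore).toNormedSpace

lemma coe_ipSeminorm (P : InnerProductSpace.Core ℝ W) : ⇑(ipSeminorm P) = ipNorm P := rfl

lemma inner_add_ipNorm_sub_le_of_isMinOn {G v α α' γ : ℝ} {P : InnerProductSpace.Core ℝ W}
    {θ x : W} (hG : 0 < G) (hv : 4 * G ^ 2 ≤ v) (hα' : 0 < α') (hαα' : α' ≤ α) (hγ : 0 ≤ γ)
    (hγG : γ ≤ G) (hg : ∀ h, ⟪g, h⟫_ℝ ≤ γ * ipNorm P h)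
    (hmin : IsMinOn (fun y => ⟪θ, y⟫_ℝ + potential G v α (ipNorm P y)) Set.univ x) (y : W) :
    ⟪θ, x⟫_ℝ + potential G v α (ipNorm P x) + ⟪g, x⟫_ℝ - 100 * (γ ^ 2 * (α / √v)) ≤
      ⟪θ + g, y⟫_ℝ + potential G (v + γ ^ 2) α' (ipNorm P y) := by
  rw [inner_add_left]
  exact @add_apply_sub_le_of_isMinOn W P.toNormedAddCommGroup (InnerProductSpace.ofCore _)
    G v α α' γ hG hv hα' hαα' hγ hγG (innerₗ W θ) (innerₗ W g) x hg hmin y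

end DualNorm

section Regret

variable {G ε : ℝ} {N : ℕ → W → ℝ} {g : ℕ → W} {t T : ℕ}

lemma four_mul_sq_le_V : 4 * G ^ 2 ≤ V G N g t :=
  le_add_of_nonneg_right (Finset.sum_nonneg fun _ _ => sq_nonneg _)

lemma V_pos (hG : 0 < G) : 0 < V G N g t := lt_of_lt_of_le (by positivity) four_mul_sq_le_V

lemma V_succ (ht : 1 ≤ t) : V G N g (t + 1) = V G N g t + dualNorm (N t) (g t) ^ 2 := by
  rw [V, V, Finset.sum_Ico_succ_top ht, add_assoc]

lemma V_mono : Monotone (V G N g) := fun _ _ hst =>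
  add_le_add_right (Finset.sum_le_sum_of_subset_of_nonneg (Finset.Ico_subset_Ico_right hst)
    fun _ _ _ => sq_nonneg _) _

lemma V_succ_le (h : 1 ≤ t → dualNorm (N t) (g t) ^ 2 ≤ G ^ 2) :
    V G N g (t + 1) ≤ 5 / 4 * V G N g t := by
  have hV := four_mul_sq_le_V (G := G) (N := N) (g := g) (t := t)
  rcases Nat.eq_zero_or_pos t with rfl | ht
  · simp only [V, zero_add, Finset.Ico_self, Finset.Ico_eq_empty_of_le zero_le_one] at hV ⊢
    nlinarith
  · linarith [V_succ (G := G) (N := N) (g := g) ht, h ht]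

lemma psi_eq_potential (hG : 0 < G) (hε : 0 < ε) {y : W} (hy : 0 ≤ N t y) :
    psi G ε N g t y = potential G (V G N g t) (alpha G ε (V G N g t)) (N t y) :=
  congrArg (3 * ·) <| intervalIntegral.integral_congr fun _ hx =>
    slope_eq_radialSlope hG (V_pos hG) (alpha_pos hG hε four_mul_sq_le_V).le
      (uIcc_subset_Ici le_rfl hy hx)

lemma psi_nonneg (hG : 0 < G) (hε : 0 < ε) {y : W} (hy : 0 ≤ N t y) : 0 ≤ psi G ε N g t y := by
  rw [psi_eq_potential hG hε hy]
  exact potential_nonneg hG (V_pos hG) (alpha_pos hG hε four_mul_sq_le_V).le hy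

lemma objective_add_inner_sub_le (hG : 0 < G) (hε : 0 < ε) (ht : 1 ≤ t)
    {P : InnerProductSpace.Core ℝ W} (hN : N t = ipNorm P) (hmono : ∀ y, N t y ≤ N (t + 1) y)
    (hfin : ∃ c, ∀ h, ⟪g t, h⟫_ℝ ≤ c * N t h) (hdual : dualNorm (N t) (g t) ≤ G) {x : W}
    (hmin : IsMinOn (objective G ε N g t) Set.univ x) (y : W) :
    objective G ε N g t x + ⟪g t, x⟫_ℝ - 200 * (G * ε) *
        (1 / Real.log (V G N g t / G ^ 2) - 1 / Real.log (V G N g (t + 1) / G ^ 2)) ≤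
      objective G ε N g (t + 1) y := by
  have hNp : N t = ipSeminorm P := hN
  have hN0 (z : W) : 0 ≤ N t z := by rw [hNp]; exact apply_nonneg _ z
  have hV := four_mul_sq_le_V (G := G) (N := N) (g := g) (t := t)
  have hα' : 0 < alpha G ε (V G N g (t + 1)) := alpha_pos hG hε four_mul_sq_le_V
  have hγ : 0 ≤ dualNorm (N t) (g t) := by rw [hNp]; exact dualNorm_nonneg
  have hg (h : W) : ⟪g t, h⟫_ℝ ≤ dualNorm (N t) (g t) * ipNorm P h := by
    obtain ⟨c, hc⟩ := hfin
    rw [hNp] at hc ⊢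
    exact inner_le_dualNorm_mul hc h
  have hobj (z : W) : objective G ε N g t z = ⟪∑ s ∈ Finset.Ico 1 t, g s, z⟫_ℝ +
      potential G (V G N g t) (alpha G ε (V G N g t)) (ipNorm P z) := by
    rw [objective, psi_eq_potential hG hε (hN0 z), hN]
  have hobj' : ⟪∑ s ∈ Finset.Ico 1 t, g s + g t, y⟫_ℝ +
      potential G (V G N g (t + 1)) (alpha G ε (V G N g (t + 1))) (ipNorm P y) ≤
        objective G ε N g (t + 1) y := by
    have hy : 0 ≤ N (t + 1) y := (hN0 y).trans (hmono y)
    rw [objective, Finset.sum_Ico_succ_top ht, psi_eq_potential hG hε hy, ← hN]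
    gcongr
    exact potential_monotoneOn hG (V_pos hG) hα'.le (hN0 y) hy (hmono y)
  have hround := inner_add_ipNorm_sub_le_of_isMinOn hG hV hα' (alpha_anti hG hε.le hV
    (V_mono t.le_succ)) hγ hdual hg (by rwa [funext hobj] at hmin) y
  have herror := sq_mul_alpha_div_sqrt_le hG hε.le hV hγ hdual
  rw [← V_succ ht] at hround herror
  rw [hobj]
  linarith

lemma add_sum_le_of_add_le {X : Type*} {F : ℕ → X → ℝ} {x : ℕ → X} {c : ℕ → ℝ} {b : ℝ}
    (hb : ∀ y, b ≤ F 1 y) (hF : ∀ t ∈ Finset.Icc 1 T, ∀ y, F t (x t) + c t ≤ F (t + 1) y)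
    (y : X) : b + ∑ t ∈ Finset.Icc 1 T, c t ≤ F (T + 1) y := by
  induction T generalizing y with
  | zero => simpa using hb y
  | succ T ih =>
    rw [Finset.sum_Icc_succ_top (Nat.le_add_left 1 T), ← add_assoc]
    have hprev := ih (fun t ht => hF t (Finset.Icc_subset_Icc_right T.le_succ ht)) (x (T + 1))
    linarith [hF (T + 1) (Finset.right_mem_Icc.2 (Nat.le_add_left 1 T)) y]

lemma regret_le_sum_inner_sub {l : ℕ → W → ℝ} {w : ℕ → W}
    (hl : ∀ t ∈ Finset.Icc 1 T, IsSubgradientAt (l t) (g t) (w t)) (u : W) :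
    regret l w T u ≤
      ∑ t ∈ Finset.Icc 1 T, ⟪g t, w t⟫_ℝ - ⟪∑ t ∈ Finset.Ico 1 (T + 1), g t, u⟫_ℝ := by
  rw [regret, Finset.Ico_add_one_right_eq_Icc, sum_inner, ← Finset.sum_sub_distrib]
  refine Finset.sum_le_sum fun t ht => ?_
  have h := hl t ht u
  rw [inner_sub_right] at h
  linarith

variable {P : ℕ → InnerProductSpace.Core ℝ W} {w : ℕ → W}

lemma sum_inner_le_objective_add (hG : 0 < G) (hε : 0 < ε) (hN : ∀ t, N t = ipNorm (P t))
    (hmono : ∀ t ∈ Finset.Icc 1 T, ∀ y, N t y ≤ N (t + 1) y)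
    (hfin : ∀ t ∈ Finset.Icc 1 T, ∃ c, ∀ h, ⟪g t, h⟫_ℝ ≤ c * N t h)
    (hdual : ∀ t ∈ Finset.Icc 1 T, dualNorm (N t) (g t) ≤ G)
    (hmin : ∀ t ∈ Finset.Icc 1 T, IsMinOn (objective G ε N g t) Set.univ (w t)) (u : W) :
    ∑ t ∈ Finset.Icc 1 T, ⟪g t, w t⟫_ℝ ≤ objective G ε N g (T + 1) u + 200 * (G * ε) := by
  have : 0 < G * ε := mul_pos hG hε
  have hlog (t : ℕ) : 1 ≤ Real.log (V G N g t / G ^ 2) := one_le_log_div_sq hG four_mul_sq_le_V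
  let F (t : ℕ) (y : W) : ℝ :=
    objective G ε N g t y - 200 * (G * ε) * (1 / Real.log (V G N g t / G ^ 2))
  have hinit (y : W) : -(200 * (G * ε)) ≤ F 1 y := by
    have hpsi : 0 ≤ psi G ε N g 1 y := psi_nonneg hG hε (by rw [hN]; exact Real.sqrt_nonneg _)
    have hinv : 200 * (G * ε) * (1 / Real.log (V G N g 1 / G ^ 2)) ≤ 200 * (G * ε) :=
      mul_le_of_le_one_right (by positivity) ((div_le_one (one_pos.trans_le (hlog 1))).2 (hlog 1))
    simp only [F, objective, Finset.Ico_self, Finset.sum_empty, inner_zero_left]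
    linarith
  have hstep (t : ℕ) (ht : t ∈ Finset.Icc 1 T) (y : W) :
      F t (w t) + ⟪g t, w t⟫_ℝ ≤ F (t + 1) y := by
    have h := objective_add_inner_sub_le hG hε (Finset.mem_Icc.1 ht).1 (hN t) (hmono t ht)
      (hfin t ht) (hdual t ht) (hmin t ht) y
    simp only [F]
    linarith
  have hsum := add_sum_le_of_add_le hinit hstep u
  have hlast : 0 ≤ 200 * (G * ε) * (1 / Real.log (V G N g (T + 1) / G ^ 2)) := by
    have := hlog (T + 1)
    positivity
  simp only [F] at hsum
  linarith

lemma psi_succ_le (hG : 0 < G) (hε : 0 < ε) {u : W} (hu : 0 ≤ N (T + 1) u)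
    (hdual : 1 ≤ T → dualNorm (N T) (g T) ^ 2 ≤ G ^ 2) :
    psi G ε N g (T + 1) u ≤
      24 * (G * ε + (1 + Real.log (Real.log (V G N g T / G ^ 2))) * (N (T + 1) u *
        rate G (V G N g T) (Real.log (N (T + 1) u * √(V G N g T) / (ε * G) + 1)))) := by
  set v' := V G N g (T + 1)
  set L := logRatio (alpha G ε v') (N (T + 1) u)
  have hv' : 0 < v' := V_pos hG
  calc psi G ε N g (T + 1) u = potential G v' (alpha G ε v') (N (T + 1) u) :=
        psi_eq_potential hG hε hu
    _ ≤ 3 * (N (T + 1) u * radialSlope G v' (alpha G ε v') (N (T + 1) u)) :=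
        potential_le hG hv' (alpha_pos hG hε four_mul_sq_le_V).le hu
    _ ≤ 3 * (N (T + 1) u * (2 * rate G v' L)) := by
        gcongr
        exact stepCost_le_two_mul_rate hG hv'
    _ = 6 * (N (T + 1) u * rate G v' L) := by ring
    _ ≤ 6 * (4 * _) :=
        mul_le_mul_of_nonneg_left (mul_rate_logRatio_alpha_le hG hε four_mul_sq_le_V
          (V_mono T.le_succ) (V_succ_le hdual) hu) (by norm_num)
    _ = _ := by ring

end Regret

end FTRL

theorem mainTheorem8_general {W : Type*} [NormedAddCommGroup W] [InnerProductSpace ℝ W]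
    {T : ℕ} {P : ℕ → InnerProductSpace.Core ℝ W} {N : ℕ → W → ℝ}
    (hN : ∀ t, N t = FTRL.ipNorm (P t))
    (hmono : ∀ t ∈ Finset.Icc 1 T, ∀ v : W, N t v ≤ N (t + 1) v)
    {l : ℕ → W → ℝ} {g w : ℕ → W} {G ε : ℝ} (hG : 0 < G) (hε : 0 < ε)
    (hl : ∀ t ∈ Finset.Icc 1 T, FTRL.IsSubgradientAt (l t) (g t) (w t))
    (hfin : ∀ t ∈ Finset.Icc 1 T, ∃ c : ℝ, ∀ v : W, ⟪g t, v⟫_ℝ ≤ c * N t v)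
    (hdual : ∀ t ∈ Finset.Icc 1 T, FTRL.dualNorm (N t) (g t) ≤ G)
    (hmin : ∀ t ∈ Finset.Icc 1 T, IsMinOn (FTRL.objective G ε N g t) Set.univ (w t))
    (u : W) :
    FTRL.regret l w T u ≤
      224 * (G * ε +
        (1 + Real.log (Real.log (FTRL.V G N g T / G ^ 2))) *
          (N (T + 1) u *
            max
              (√(FTRL.V G N g T *
                Real.log (N (T + 1) u * √(FTRL.V G N g T) / (ε * G) + 1)))
              (G * Real.log (N (T + 1) u * √(FTRL.V G N g T) / (ε * G) + 1)))) := by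
  have hu : 0 ≤ N (T + 1) u := by rw [hN]; exact Real.sqrt_nonneg _
  have hdual_sq (hT : 1 ≤ T) : FTRL.dualNorm (N T) (g T) ^ 2 ≤ G ^ 2 :=
    pow_le_pow_left₀ (by rw [hN, ← FTRL.coe_ipSeminorm]; exact FTRL.dualNorm_nonneg)
      (hdual T (Finset.right_mem_Icc.2 hT)) 2
  have hregret := FTRL.regret_le_sum_inner_sub hl u
  have hsum := FTRL.sum_inner_le_objective_add hG hε hN hmono hfin hdual hmin u
  have hpsi := FTRL.psi_succ_le hG hε hu hdual_sq
  have hloglog : 0 ≤ Real.log (Real.log (FTRL.V G N g T / G ^ 2)) :=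
    Real.log_nonneg (FTRL.one_le_log_div_sq hG FTRL.four_mul_sq_le_V)
  have hrate := FTRL.rate_nonneg (G := G) (v := FTRL.V G N g T)
    (L := Real.log (N (T + 1) u * √(FTRL.V G N g T) / (ε * G) + 1))
  have hbound := mul_nonneg (add_nonneg zero_le_one hloglog) (mul_nonneg hu hrate)
  rw [FTRL.objective] at hsum
  rw [FTRL.rate] at hpsi hbound
  linarith

theorem mainTheorem8 :
    ∃ C : ℝ, 0 < C ∧
      ∀ (W : Type*) [NormedAddCommGroup W] [InnerProductSpace ℝ W] [CompleteSpace W]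
        (T : ℕ) (P : ℕ → InnerProductSpace.Core ℝ W) (N : ℕ → W → ℝ)
        (_ : ∀ t, N t = FTRL.ipNorm (P t))
        (_ : ∀ t ∈ Finset.Icc 1 (T + 1), ∀ v : W, ‖v‖ ≤ N t v)
        (_ : ∀ t ∈ Finset.Icc 1 T, ∀ v : W, N t v ≤ N (t + 1) v)
        (l : ℕ → W → ℝ) (g w : ℕ → W) (G ε : ℝ) (_ : 0 < G) (_ : 0 < ε)
        (_ : ∀ t ∈ Finset.Icc 1 T, ConvexOn ℝ Set.univ (l t))
        (_ : ∀ t ∈ Finset.Icc 1 T, FTRL.IsSubgradientAt (l t) (g t) (w t))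
        (_ : ∀ t ∈ Finset.Icc 1 T, FTRL.dualNorm (N t) (g t) ≤ G)
        (_ : ∀ t ∈ Finset.Icc 1 T, IsMinOn (FTRL.objective G ε N g t) Set.univ (w t))
        (u : W),
        FTRL.regret l w T u ≤
          C * (G * ε +
            (1 + Real.log (Real.log (FTRL.V G N g T / G ^ 2))) *
              (N (T + 1) u *
                max
                  (√(FTRL.V G N g T *
                    Real.log (N (T + 1) u * √(FTRL.V G N g T) / (ε * G) + 1)))
                  (G * Real.log (N (T + 1) u * √(FTRL.V G N g T) / (ε * G) + 1)))) :=
  ⟨224, by norm_num, fun _ _ _ _ T _ _ hN hdom hmono _ g _ _ _ hG hε _ hl hdual hmin =>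
    mainTheorem8_general hN hmono hG hε hl (fun t ht => ⟨‖g t‖, fun v =>
      (real_inner_le_norm _ v).trans <| mul_le_mul_of_nonneg_left
        (hdom t (Finset.Icc_subset_Icc_right T.le_succ ht) v) (norm_nonneg _)⟩) hdual hmin⟩
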